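/- The model of computation is the deterministic multi-tape Turing machine with input alphabet $\{0,1\}$. A *proper complexity function* is a non-decreasing function $f:\mathbb{N}\to\mathbb{N}$ for which there is a multi-tape Turing machine with read-only input that, on every input $w\in\{0,1\}^*$, computes the string $1^{f(|w|)}$ in $O(|w|+f(|w|))$ steps and uses $O(f(|w|))$ space besides its input. A set $S\subseteq\{0,1\}^*$ is *generic* if $$\lim_{n\to\infty}\frac{|S\cap B_n|}{|B_n|}=1,\qquad B_n=\{w\in\{0,1\}^* : |w|\le n\}.$$ A language $L$ is *computable in time* $T(n)$ if some machine halts on every word $w\in\{0,1\}^*$ with the correct decision on whether $w\in L$, and does so within $T(|w|)$ steps for all words $w$ with at most finitely many exceptions. It is *generically computable in time* $T(n)$ if there is a machine $M$ for which the set of words $w$ such that $M$, on input $w$, halts within $T(|w|)$ steps with the correct decision on whether $w\in L$ is generic; nothing is required of $M$ on other words. **Theorem 9.3.** Let $f$ be a proper complexity function with $f(n)\ge n$ for all $n$. Then there is a language $L\subseteq\{0,1\}^*$ that is computable in time $f(n)^3$ but, for every constant $C\in\mathbb{N}$, is not generically computable in time $C\,f(n)$. In particular, $L$ is not generically computable in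 time $f(n)$. -/

import Mathlib

open Filter Topology

/-- Tape symbols over a set `A` of auxiliary symbols: the blank, the two letters of `{0,1}`
(`bit false` is `0`, `bit true` is `1`), and the auxiliary symbols. -/
inductive TapeSym (A : Type) : Type
  | blank : TapeSym A
  | bit (b : Bool) : TapeSym A
  | aux (a : A) : TapeSym A

/-- Head moves. -/
inductive HeadMove : Type
  | left
  | stay
  | right

/-- The displacement of the head for each move. -/
def HeadMove.toInt : HeadMove → ℤ
  | .left => -1
  | .stay => 0
  | .right => 1

/-- Control states over a set `Q` of working states: a working state, or one of the three
halting states "yes" (accept), "no" (reject) and "h" (halt with output, no decision). -/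
inductive Ctrl (Q : Type) : Type
  | work (q : Q) : Ctrl Q
  | yes : Ctrl Q
  | no : Ctrl Q
  | halt : Ctrl Q

/-- A deterministic multi-tape Turing machine with input alphabet `{0,1}`. It has `k + 1` tapes,
infinite in both directions: tape `0` is the input tape, the last tape is the output tape when
the machine computes a function. The transition function maps a working state and the scanned
symbols to the next control state and, for each tape, the symbol written and the head move. -/
structure MultitapeTM : Type 1 where
  k : ℕ
  A : Type
  finite_A : Finite A
  Q : Type
  finite_Q : Finite Q
  start : Q
  δ : Q → (Fin (k + 1) → TapeSym A) → Ctrl Q × (Fin (k + 1) → TapeSym A × HeadMove)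

namespace MultitapeTM

/-- A configuration: control state, contents of all tapes, positions of all heads. -/
structure Config (M : MultitapeTM) : Type where
  state : Ctrl M.Q
  tape : Fin (M.k + 1) → ℤ → TapeSym M.A
  head : Fin (M.k + 1) → ℤ

/-- The tape holding the word `w` in the cells `0, …, |w| - 1`, blank elsewhere. -/
def wordTape {A : Type} (w : List Bool) : ℤ → TapeSym A
  | Int.ofNat n => (w[n]?).elim TapeSym.blank TapeSym.bit
  | Int.negSucc _ => TapeSym.blank

/-- The initial configuration on input `w`. -/
def init (M : MultitapeTM) (w : List Bool) : M.Config where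
  state := .work M.start
  tape := fun i => if i = 0 then wordTape w else wordTape []
  head := fun _ => 0

/-- One step of computation; a halted configuration does not change. -/
def step (M : MultitapeTM) (c : M.Config) : M.Config :=
  match c.state with
  | .work q =>
    let r := M.δ q (fun i => c.tape i (c.head i))
    { state := r.1
      tape := fun i => Function.update (c.tape i) (c.head i) (r.2 i).1
      head := fun i => c.head i + (r.2 i).2.toInt }
  | _ => c

/-- The configuration after `t` steps on input `w`. -/
def run (M : MultitapeTM) (w : List Bool) (t : ℕ) : M.Config :=
  M.step^[t] (M.init w)

/-- `M` accepts `w` in at most `t` steps. -/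
def AcceptsIn (M : MultitapeTM) (w : List Bool) (t : ℕ) : Prop :=
  (M.run w t).state = .yes

/-- `M` rejects `w` in at most `t` steps. -/
def RejectsIn (M : MultitapeTM) (w : List Bool) (t : ℕ) : Prop :=
  (M.run w t).state = .no

/-- On input `w`, `M` halts after at most `t` steps with the correct decision on whether
`w` belongs to `L`. -/
def DecidesIn (M : MultitapeTM) (L : Language Bool) (w : List Bool) (t : ℕ) : Prop :=
  (w ∈ L ∧ M.AcceptsIn w t) ∨ (w ∉ L ∧ M.RejectsIn w t)

/-- On input `w`, `M` halts after at most `t` steps with the word `u` on its output tape. -/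
def OutputsIn (M : MultitapeTM) (w u : List Bool) (t : ℕ) : Prop :=
  (M.run w t).state = .halt ∧ (M.run w t).tape (Fin.last M.k) = wordTape u

/-- The input is read-only: `M` never changes a symbol on tape `0`, and its input head never
leaves the input word and the two blank cells next to it. -/
def ReadOnlyInput (M : MultitapeTM) : Prop :=
  (∀ q σ, ((M.δ q σ).2 0).1 = σ 0) ∧
    ∀ w t, -1 ≤ (M.run w t).head 0 ∧ (M.run w t).head 0 ≤ (w.length : ℤ)

/-- The space used besides the input in the first `t` steps on input `w`: the total number of
cells visited on the tapes other than the input tape. -/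
def spaceUsed (M : MultitapeTM) (w : List Bool) (t : ℕ) : ℕ :=
  ∑ i : Fin M.k, ((Finset.range (t + 1)).image fun s => (M.run w s).head i.succ).card

end MultitapeTM

/-- `f` is a proper complexity function: it is non-decreasing, and some multi-tape Turing
machine with read-only input computes, on every input `w`, the string `1^{f(|w|)}` in
`O(|w| + f(|w|))` steps, using `O(f(|w|))` space besides its input. -/
def IsProperComplexity (f : ℕ → ℕ) : Prop :=
  Monotone f ∧ ∃ (M : MultitapeTM) (c : ℕ), M.ReadOnlyInput ∧ ∀ w : List Bool,
    ∃ t ≤ c * (w.length + f w.length) + c,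
      M.OutputsIn w (List.replicate (f w.length) true) t ∧
        M.spaceUsed w t ≤ c * f w.length + c

/-- `L` is computable in deterministic time `T(n)`: some machine decides every word correctly,
within `T(|w|)` steps for all words `w` with at most finitely many exceptions. -/
def ComputableInTime (L : Language Bool) (T : ℕ → ℕ) : Prop :=
  ∃ M : MultitapeTM, (∀ w, ∃ t, M.DecidesIn L w t) ∧
    ∃ N : ℕ, ∀ w : List Bool, N ≤ w.length → M.DecidesIn L w (T w.length)

/-- The ball `B_n` of all words of length at most `n`. -/
def wordBall (n : ℕ) : Set (List Bool) := {w | w.length ≤ n}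

/-- The proportion `ρ_n(S) = |S ∩ B_n| / |B_n|`. -/
noncomputable def wordDensity (S : Set (List Bool)) (n : ℕ) : ℝ :=
  ((S ∩ wordBall n).ncard : ℝ) / ((wordBall n).ncard : ℝ)

/-- `S` is generic: its asymptotic density `lim ρ_n(S)` exists and equals `1`. -/
def IsGeneric (S : Set (List Bool)) : Prop :=
  Tendsto (wordDensity S) atTop (𝓝 1)

/-- `L` is generically computable in time `T(n)`: for some machine, the set of words `w` whose
membership in `L` it decides correctly within `T(|w|)` steps is generic. Nothing is required
of the machine on other words. -/
def GenericallyComputableInTime (L : Language Bool) (T : ℕ → ℕ) : Prop :=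
  ∃ M : MultitapeTM, IsGeneric {w | M.DecidesIn L w (T w.length)}

/-! ### Tapes seen from the head -/

/-! The proof diagonalises against programs placed in a prefix of the input. A machine `U` treats
its input `w` both as a word that begins with a program and as the data of that program; it
interprets the program under a clock, and `L` is the set of words that `U` accepts. For every
machine `M'` there is a program `u` whose interpretation on `u ++ v` yields the opposite of the
answer of `M'` on `u ++ v`, whatever the continuation `v`. The continuation is harmless because
instructions are located by counting from the left end, so the program head never leaves the table.
If `M'` were correct within `C * f n` steps on a long word `u ++ v`, the clock would let the
interpretation finish, and `U` would contradict `M'`. Hence `M'` fails on all long words with prefix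
`u`. These fill more than the fraction `1 / 2 ^ (|u| + 1)` of every large ball, which excludes
genericity (`not_isGeneric_of_prefix`).

The interpreter is a fixed machine, whereas `M'` has arbitrarily many tapes and symbols. The passage
(`exists_program`) has two stages. A sweeping machine stores each tape of `M'` as two stacks, all
stacks lying in parallel one-hot tracks of a single binary tape. One step of `M'` is one sweep forth
and back over as many blocks as there were steps so far, so `t` steps cost `O(t ^ 2)`
(`atHome_step`, `atHome_iterate`). The interpreter then runs any such one-tape machine with an
overhead that depends only on the program (`interp_cycle`, `exists_table`).

The clock must therefore beat every quadratic function of `f` and stay below `f ^ 3`. The machine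
computing `1^{f(n)}` works for at least `f n` steps, since it has to write its output, and for
linearly many at most (`exists_timer`). Its number of steps, divided by a large constant, is
recorded in unary on three counters, whose heads then form an odometer running for a cubic number of
steps (`clock_run`). The division makes the total fit below `f ^ 3` (`clock_le_cube`) without
spoiling the cubic order (`quadratic_le_clock`). As the clock always stops, `U` decides every word.
-/

instance {A : Type} : Inhabited (TapeSym A) := ⟨.blank⟩

theorem TapeSym.default_eq {A : Type} : (default : TapeSym A) = .blank := rfl

/-- Write `a` in the scanned cell, then move the head. The head always scans cell `0`. -/
def act {Γ : Type} (T : ℤ → Γ) (a : Γ) (m : HeadMove) : ℤ → Γ :=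
  fun z => Function.update T 0 a (z + m.toInt)

/-- The tape with `L` to the left of the head (nearest cell first) and `R` from the head on. -/
def splitTape {Γ : Type} [Inhabited Γ] (L R : List Γ) : ℤ → Γ
  | Int.ofNat n => R.getD n default
  | Int.negSucc n => L.getD n default

/-! ### Tapes as pairs of lists around the head -/

section SplitTape

variable {Γ : Type} [Inhabited Γ]

@[simp] theorem splitTape_zero (L R : List Γ) : splitTape L R 0 = R.headD default := by
  cases R <;> rfl

theorem act_splitTape_right (L R : List Γ) (a : Γ) :
    act (splitTape L R) a .right = splitTape (a :: L) R.tail := by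
  funext z
  rcases z with n | n
  · have h : (Int.ofNat n + HeadMove.right.toInt) = ((n + 1 : ℕ) : ℤ) := by
      simp [HeadMove.toInt]
    rw [act, h, Function.update_of_ne (by omega)]
    cases R <;> simp [splitTape]
  · rcases n with _ | n
    · simp [act, HeadMove.toInt, splitTape]
    · have h : (Int.negSucc (n + 1) + HeadMove.right.toInt) = Int.negSucc n := by
        simp only [HeadMove.toInt]; omega
      rw [act, h, Function.update_of_ne (by omega)]
      simp [splitTape]

theorem act_splitTape_stay (L R : List Γ) (a : Γ) :
    act (splitTape L R) a .stay = splitTape L (a :: R.tail) := by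
  funext z
  rcases z with n | n
  · rcases n with _ | n
    · simp [act, HeadMove.toInt, splitTape]
    · have h : (Int.ofNat (n + 1) + HeadMove.stay.toInt) = ((n + 1 : ℕ) : ℤ) := by
        simp [HeadMove.toInt]
      rw [act, h, Function.update_of_ne (by omega)]
      cases R <;> simp [splitTape]
  · have h : (Int.negSucc n + HeadMove.stay.toInt) = Int.negSucc n := by
      simp [HeadMove.toInt]
    rw [act, h, Function.update_of_ne (by omega)]
    simp [splitTape]

theorem act_splitTape_left (L R : List Γ) (a : Γ) :
    act (splitTape L R) a .left = splitTape L.tail (L.headD default :: a :: R.tail) := by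
  funext z
  rcases z with n | n
  · rcases n with _ | _ | n
    · have h : (Int.ofNat 0 + HeadMove.left.toInt) = Int.negSucc 0 := by
        simp [HeadMove.toInt]
      rw [act, h, Function.update_of_ne (by omega)]
      cases L <;> simp [splitTape]
    · simp [act, HeadMove.toInt, splitTape]
    · have h : (Int.ofNat (n + 1 + 1) + HeadMove.left.toInt) = ((n + 1 : ℕ) : ℤ) := by
        simp [HeadMove.toInt]
      rw [act, h, Function.update_of_ne (by omega)]
      cases R <;> simp [splitTape]
  · have h : (Int.negSucc n + HeadMove.left.toInt) = Int.negSucc (n + 1) := by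
      simp only [HeadMove.toInt]; omega
    rw [act, h, Function.update_of_ne (by omega)]
    cases L <;> simp [splitTape]

/-- Cells beyond the lists read as `default`, so an explicit blank at the end is invisible. This
absorbs the blank that a head leaves in the list when it turns at the end. -/
theorem splitTape_append_default (L R : List Γ) :
    splitTape L (R ++ [default]) = splitTape L R := by
  funext z
  rcases z with n | n
  · simp only [splitTape, List.getD_eq_getElem?_getD, List.getElem?_append]
    split_ifs with h
    · rfl
    · rw [List.getElem?_eq_none (l := R) (by omega)]
      rcases hn : n - R.length with _ | m <;> simp
  · rfl

theorem splitTape_left_default (R : List Γ) :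
    splitTape [default] R = splitTape [] R := by
  funext z
  rcases z with n | n
  · rfl
  · rcases n with _ | n <;> simp [splitTape]

theorem splitTape_right_default (L : List Γ) :
    splitTape L [default] = splitTape L [] := splitTape_append_default L []

/-- The tape on which a head sweeping right (`d = true`) or left (`d = false`) has passed the
cells `P` (latest first), and has the cells `R` ahead of it. -/
def sweepTape (d : Bool) (P R : List Γ) : ℤ → Γ :=
  if d then splitTape P R else splitTape R.tail (R.headD default :: P)

/-- The move of a sweeping head. -/
def sweepMove (d : Bool) : HeadMove := if d then .right else .left

@[simp] theorem sweepTape_zero (d : Bool) (P R : List Γ) :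
    sweepTape d P R 0 = R.headD default := by
  cases d <;> simp [sweepTape]

theorem act_sweepTape (d : Bool) (P R : List Γ) (a : Γ) :
    act (sweepTape d P R) a (sweepMove d) = sweepTape d (a :: P) R.tail := by
  cases d
  · simp [sweepTape, sweepMove, act_splitTape_left]
  · simp [sweepTape, sweepMove, act_splitTape_right]

/-- At the end of a sweep the head scans the blank just past `P`. One move back makes `P`, latest
cell first, exactly the list ahead of the opposite sweep, so one description serves both directions.
-/
theorem act_sweepTape_turn (d : Bool) (P : List Γ) :
    act (sweepTape d P []) default (sweepMove !d) = sweepTape (!d) [] P := by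
  cases d
  · simp [sweepTape, sweepMove, act_splitTape_right, splitTape_left_default]
  · simp only [sweepTape, sweepMove, act_splitTape_left, if_true, Bool.not_true, Bool.false_eq_true,
      if_false, List.tail_nil]
    exact splitTape_append_default P.tail [P.headD default]

end SplitTape

/-- The tape `T` with the head on cell `x`. -/
def shiftTape {Γ : Type} (T : ℤ → Γ) (x : ℤ) : ℤ → Γ := fun z => T (x + z)

@[simp] theorem shiftTape_apply_zero {Γ : Type} (T : ℤ → Γ) (x : ℤ) : shiftTape T x 0 = T x := by
  simp [shiftTape]

theorem shiftTape_zero {Γ : Type} (T : ℤ → Γ) : shiftTape T 0 = T := by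
  funext z; simp [shiftTape]

theorem act_shiftTape {Γ : Type} (T : ℤ → Γ) (x : ℤ) (m : HeadMove) :
    act (shiftTape T x) (T x) m = shiftTape T (x + m.toInt) := by
  have h : Function.update (shiftTape T x) 0 (T x) = shiftTape T x := by
    rw [Function.update_eq_self_iff]; simp
  funext z
  rw [act, h]
  simp only [shiftTape]
  congr 1
  ring

theorem act_stay_self {Γ : Type} (T : ℤ → Γ) : act T (T 0) .stay = T := by
  have := act_shiftTape T 0 .stay
  rwa [shiftTape_zero, HeadMove.toInt, add_zero, shiftTape_zero] at this

theorem act_comp {Γ Δ : Type} (g : Γ → Δ) (T : ℤ → Γ) (a : Γ) (m : HeadMove) :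
    act (g ∘ T) (g a) m = g ∘ act T a m := by
  funext z
  simp only [act, Function.comp_apply, Function.update_apply]
  split_ifs <;> rfl

namespace MultitapeTM

theorem wordTape_natCast {A : Type} (w : List Bool) (n : ℕ) :
    (wordTape w (n : ℤ) : TapeSym A) = (w[n]?).elim TapeSym.blank TapeSym.bit := rfl

theorem wordTape_of_neg {A : Type} (w : List Bool) {z : ℤ} (hz : z < 0) :
    (wordTape w z : TapeSym A) = TapeSym.blank := by
  obtain ⟨n, rfl⟩ := Int.eq_negSucc_of_lt_zero hz
  rfl

theorem wordTape_eq_splitTape {A : Type} (w : List Bool) :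
    (wordTape w : ℤ → TapeSym A) = splitTape [] (w.map .bit) := by
  funext z
  rcases z with n | n
  · simp only [wordTape, splitTape, List.getD_eq_getElem?_getD, List.getElem?_map]
    cases w[n]? <;> rfl
  · simp [wordTape, splitTape]; rfl

theorem wordTape_nil {A : Type} (z : ℤ) : (wordTape [] z : TapeSym A) = .blank := by
  rcases z with n | n <;> simp [wordTape]

theorem wordTape_of_length_le {A : Type} (w : List Bool) {z : ℤ} (hz : (w.length : ℤ) ≤ z) :
    (wordTape w z : TapeSym A) = TapeSym.blank := by
  obtain ⟨n, rfl⟩ := Int.eq_ofNat_of_zero_le (by omega : 0 ≤ z)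
  rw [wordTape_natCast, List.getElem?_eq_none (by omega)]
  rfl

theorem act_shiftTape_wordTape {A : Type} (u : List Bool) (b : Bool) :
    act (shiftTape (wordTape u : ℤ → TapeSym A) u.length) (.bit b) .right =
      shiftTape (wordTape (u ++ [b])) ((u.length : ℤ) + 1) := by
  funext z
  simp only [act, shiftTape, Function.update_apply, HeadMove.toInt]
  by_cases hz : z + 1 = 0
  · have h : (u.length : ℤ) + 1 + z = (u.length : ℕ) := by omega
    rw [if_pos hz, h, wordTape_natCast]
    simp
  · rw [if_neg hz]
    have h : (u.length : ℤ) + (z + 1) = (u.length : ℤ) + 1 + z := by ring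
    rw [h]
    generalize hy : (u.length : ℤ) + 1 + z = y
    rcases y with n | n
    · simp only [wordTape]
      rw [List.getElem?_append]
      have : n ≠ u.length := by rintro rfl; apply hz; simp at hy; omega
      split_ifs with h'
      · rfl
      · rw [List.getElem?_eq_none (by omega), List.getElem?_eq_none (by simp; omega)]
    · rfl

end MultitapeTM

/-! ### Machines acting on tapes seen from the head -/

/-- A transition function with states `Q`, tapes `ι` and auxiliary symbols `A`. -/
abbrev TransFun (Q ι A : Type) : Type :=
  Q → (ι → TapeSym A) → Ctrl Q × (ι → TapeSym A × HeadMove)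

/-- A control state together with the tapes as seen from their heads. -/
abbrev ViewConfig (Q ι A : Type) : Type := Ctrl Q × (ι → ℤ → TapeSym A)

section ViewStep

variable {Q ι A : Type}

/-- One step on tapes seen from the head. -/
def viewStep (δ : TransFun Q ι A) (c : ViewConfig Q ι A) : ViewConfig Q ι A :=
  match c.1 with
  | .work q =>
    ((δ q fun i => c.2 i 0).1,
      fun i => act (c.2 i) ((δ q fun i => c.2 i 0).2 i).1 ((δ q fun i => c.2 i 0).2 i).2)
  | _ => c

/-- Whether a control state is a working state. -/
def Ctrl.IsWork (s : Ctrl Q) : Prop := ∃ q, s = .work q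

theorem viewStep_work (δ : TransFun Q ι A) (q : Q) (T : ι → ℤ → TapeSym A) :
    viewStep δ (.work q, T) =
      ((δ q fun i => T i 0).1,
        fun i => act (T i) ((δ q fun i => T i 0).2 i).1 ((δ q fun i => T i 0).2 i).2) := rfl

theorem viewStep_of_not_isWork (δ : TransFun Q ι A) {c : ViewConfig Q ι A} (h : ¬ c.1.IsWork) :
    viewStep δ c = c := by
  rcases c with ⟨_ | _ | _ | _, T⟩
  · exact absurd ⟨_, rfl⟩ h
  all_goals rfl

theorem viewStep_iterate_of_not_isWork (δ : TransFun Q ι A) {c : ViewConfig Q ι A}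
    (h : ¬ c.1.IsWork) (t : ℕ) : (viewStep δ)^[t] c = c :=
  Function.iterate_fixed (viewStep_of_not_isWork δ h) t

theorem viewStep_iterate_eq_of_le (δ : TransFun Q ι A) {c : ViewConfig Q ι A} {s t : ℕ}
    (h : ¬ ((viewStep δ)^[s] c).1.IsWork) (hst : s ≤ t) :
    (viewStep δ)^[t] c = (viewStep δ)^[s] c := by
  obtain ⟨u, rfl⟩ := Nat.exists_eq_add_of_le' hst
  rw [Function.iterate_add_apply, viewStep_iterate_of_not_isWork δ h]

theorem isWork_of_le (δ : TransFun Q ι A) {c : ViewConfig Q ι A} {s t : ℕ}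
    (h : ((viewStep δ)^[t] c).1.IsWork) (hst : s ≤ t) : ((viewStep δ)^[s] c).1.IsWork := by
  by_contra hs
  rw [viewStep_iterate_eq_of_le δ hs hst] at h
  exact hs h

theorem exists_last_isWork (δ : TransFun Q ι A) {c : ViewConfig Q ι A} {t : ℕ} (h₀ : c.1.IsWork)
    (h : ¬ ((viewStep δ)^[t] c).1.IsWork) :
    ∃ s < t, ((viewStep δ)^[s] c).1.IsWork ∧ ¬ ((viewStep δ)^[s + 1] c).1.IsWork := by
  induction t with
  | zero => exact absurd h₀ h
  | succ t ih =>
    by_cases ht : ((viewStep δ)^[t] c).1.IsWork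
    · exact ⟨t, by omega, ht, h⟩
    · obtain ⟨s, hs, h'⟩ := ih ht
      exact ⟨s, by omega, h'⟩

end ViewStep

/-- The answering control states. -/
def Ctrl.answer {Q : Type} (b : Bool) : Ctrl Q := if b then .yes else .no

theorem Ctrl.not_isWork_answer {Q : Type} (b : Bool) : ¬ (Ctrl.answer b : Ctrl Q).IsWork := by
  rintro ⟨q, hq⟩
  cases b <;> simp [Ctrl.answer] at hq

namespace MultitapeTM

/-- A configuration seen from the heads. -/
def Config.view {M : MultitapeTM} (c : M.Config) : ViewConfig M.Q (Fin (M.k + 1)) M.A :=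
  (c.state, fun i => shiftTape (c.tape i) (c.head i))

/-- A transition depends only on the tape contents relative to the heads, so absolute positions can
be dropped. Most machines below are analysed in this form. -/
theorem view_step (M : MultitapeTM) (c : M.Config) : (M.step c).view = viewStep M.δ c.view := by
  rcases c with ⟨q | _ | _ | _, T, p⟩
  · simp only [step, Config.view, viewStep_work, shiftTape_apply_zero, Prod.mk.injEq, true_and]
    funext i z
    simp only [shiftTape, act, Function.update_apply]
    have h : p i + ((M.δ q fun i => T i (p i)).2 i).2.toInt + z = p i ↔
      z + ((M.δ q fun i => T i (p i)).2 i).2.toInt = 0 := by constructor <;> intro h <;> linarith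
    simp only [h]
    split_ifs
    · rfl
    · congr 1; ring
  all_goals rfl

theorem view_init (M : MultitapeTM) (w : List Bool) :
    (M.init w).view = (.work M.start, fun i => if i = 0 then wordTape w else wordTape []) := by
  simp [init, Config.view, shiftTape_zero]

theorem view_run (M : MultitapeTM) (w : List Bool) (t : ℕ) :
    (M.run w t).view = (viewStep M.δ)^[t] (M.init w).view :=
  (Function.Semiconj.iterate_right (f := Config.view) (fun c => view_step M c) t) (M.init w)

theorem run_state (M : MultitapeTM) (w : List Bool) (t : ℕ) :
    (M.run w t).state = ((viewStep M.δ)^[t] (M.init w).view).1 := by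
  rw [← view_run]; rfl

/-- The machine with a given transition function on tapes `ι`. -/
def ofTrans {Q ι A : Type} [hA : Finite A] [hQ : Finite Q] {k : ℕ} (e : ι ≃ Fin (k + 1)) (q₀ : Q)
    (δ : TransFun Q ι A) : MultitapeTM where
  k := k
  A := A
  finite_A := hA
  Q := Q
  finite_Q := hQ
  start := q₀
  δ := fun q σ => ((δ q (σ ∘ e)).1, (δ q (σ ∘ e)).2 ∘ e.symm)

/-- Relabelling the tapes along `e` semiconjugates the step functions, so machines may be built on
whatever index type suits them; the tape sent to `0` receives the input. -/
theorem run_ofTrans_state {Q ι A : Type} [Finite A] [Finite Q] {k : ℕ} (e : ι ≃ Fin (k + 1))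
    (q₀ : Q) (δ : TransFun Q ι A) (w : List Bool) (t : ℕ) :
    ((ofTrans e q₀ δ).run w t).state = ((viewStep δ)^[t]
      (.work q₀, fun i => if e i = 0 then wordTape w else wordTape [])).1 := by
  set F : ViewConfig Q (Fin (k + 1)) A → ViewConfig Q ι A := fun c => (c.1, c.2 ∘ e) with hF
  have hs : Function.Semiconj F (viewStep (ofTrans e q₀ δ).δ) (viewStep δ) := by
    rintro ⟨_ | _ | _ | _, T⟩
    · simp only [hF, viewStep_work, ofTrans, Prod.mk.injEq]
      refine ⟨rfl, ?_⟩
      funext i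
      simp [Function.comp_def]
    all_goals rfl
  have h := hs.iterate_right t ((ofTrans e q₀ δ).init w).view
  rw [run_state]
  have h1 := congrArg Prod.fst h
  refine h1.trans ?_
  rw [view_init]
  rfl

end MultitapeTM

theorem exists_equiv_fin_map_zero {α : Type} [Finite α] (a : α) :
    ∃ (n : ℕ) (e : α ≃ Fin (n + 1)), e a = 0 := by
  obtain ⟨n, ⟨e⟩⟩ := Finite.exists_equiv_fin α
  rcases n with _ | n
  · exact (e a).elim0
  · exact ⟨n, e.trans (Equiv.swap (e a) 0), by simp⟩

/-! ### The interpreted programs -/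

/-- The letter on a tape cell, if there is one. -/
def TapeSym.toOption {A : Type} : TapeSym A → Option Bool
  | .bit b => some b
  | _ => none

/-- The symbol for a letter or a blank. -/
def TapeSym.ofOption {A : Type} : Option Bool → TapeSym A
  | some b => .bit b
  | none => .blank

@[simp] theorem TapeSym.toOption_ofOption {A : Type} (x : Option Bool) :
    (TapeSym.ofOption x : TapeSym A).toOption = x := by
  cases x <;> rfl

theorem MultitapeTM.toOption_wordTape {A : Type} (w : List Bool) (j : ℕ) :
    (wordTape w (j : ℤ) : TapeSym A).toOption = w[j]? := by
  rw [wordTape_natCast]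
  cases w[j]? <;> rfl

/-- What an instruction does: answer, or write a symbol on the data tape, move its head, and
possibly advance the input head. -/
abbrev Operation : Type := Bool ⊕ (Option Bool × HeadMove × Bool)

instance : Finite HeadMove :=
  Finite.of_surjective (fun n : Fin 3 => match n with
    | 0 => HeadMove.left
    | 1 => .stay
    | 2 => .right) (by
    rintro (_ | _ | _)
    exacts [⟨0, rfl⟩, ⟨1, rfl⟩, ⟨2, rfl⟩])

/-- The number of operations. -/
noncomputable def operationCount : ℕ := Nat.card Operation

/-- The code of an operation. -/
noncomputable def Operation.code : Operation ≃ Fin operationCount :=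
  Finite.equivFin _

/-- The number selecting an instruction by the scanned input and data symbols. -/
def symbolIndex (x d : Option Bool) : Fin 9 :=
  let v : Option Bool → Fin 3 := fun o => match o with
    | none => 0
    | some false => 1
    | some true => 2
  finProdFinEquiv (v x, v d)

/-- An instruction as a word: the base address of the next state and the operation, in unary. -/
noncomputable def encodeEntry (r : ℕ × Operation) : List Bool :=
  List.replicate r.1 true ++ false :: (List.replicate (Operation.code r.2) true ++ [false])

/-- A program as a word. -/
noncomputable def encodeTable (tab : List (ℕ × Operation)) : List Bool := tab.flatMap encodeEntry

/-- The control states of the interpreter. -/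
inductive InterpState : Type
  | rewind
  | skip (e : Fin 10)
  | skipAddress (e : Fin 10)
  | skipOperation (e : Fin 10)
  | readAddress
  | readOperation (b : Fin (operationCount + 1))

/-- The tapes of the interpreter: program, input, address register, data. -/
inductive InterpTape : Type
  | prog
  | inp
  | addr
  | dat

instance : Finite InterpState :=
  Finite.of_surjective
    (fun x : Bool ⊕ (Fin 3 × Fin 10) ⊕ Fin (operationCount + 1) =>
      match x with
      | .inl false => InterpState.rewind
      | .inl true => .readAddress
      | .inr (.inl (0, e)) => .skip e
      | .inr (.inl (1, e)) => .skipAddress e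
      | .inr (.inl (2, e)) => .skipOperation e
      | .inr (.inr b) => .readOperation b) (by
    rintro (_ | e | e | e | _ | b)
    · exact ⟨.inl false, rfl⟩
    · exact ⟨.inr (.inl (0, e)), rfl⟩
    · exact ⟨.inr (.inl (1, e)), rfl⟩
    · exact ⟨.inr (.inl (2, e)), rfl⟩
    · exact ⟨.inl true, rfl⟩
    · exact ⟨.inr (.inr b), rfl⟩)

instance : Finite InterpTape :=
  Finite.of_surjective
    (fun x : Fin 4 => match x with
      | 0 => InterpTape.prog
      | 1 => .inp
      | 2 => .addr
      | 3 => .dat) (by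
    rintro (_ | _ | _ | _)
    exacts [⟨0, rfl⟩, ⟨1, rfl⟩, ⟨2, rfl⟩, ⟨3, rfl⟩])

theorem iterate_trans {α : Type} {f : α → α} {a b c : α} {s t : ℕ} (h₁ : f^[s] a = b)
    (h₂ : f^[t] b = c) : f^[t + s] a = c := by
  rw [Function.iterate_add_apply, h₁, h₂]

section Interpreter

variable {A : Type}

/-- A function on the tapes of the interpreter, given by its values. -/
def onInterpTapes {α : Type} (p x a d : α) : InterpTape → α
  | .prog => p
  | .inp => x
  | .addr => a
  | .dat => d

/-- The transition function of the interpreter. -/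
noncomputable def interpTrans (q : InterpState) (σ : InterpTape → TapeSym A) :
    Ctrl InterpState × (InterpTape → TapeSym A × HeadMove) :=
  let go (s : Ctrl InterpState) (m : HeadMove) (a : TapeSym A × HeadMove) :=
    (s, onInterpTapes (σ .prog, m) (σ .inp, .stay) a (σ .dat, .stay))
  let same : TapeSym A × HeadMove := (σ .addr, .stay)
  match q, (σ .prog).toOption with
  | .rewind, some _ => go (.work .rewind) .left same
  | .rewind, none =>
      go (.work (.skip (symbolIndex (σ .inp).toOption (σ .dat).toOption).castSucc)) .right same
  | .skip e, _ =>
      if e = 0 then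
        if (σ .addr).toOption = none then go (.work .readAddress) .stay same
        else go (.work (.skipAddress 0)) .stay (.blank, .right)
      else go (.work (.skipAddress (e - 1))) .stay same
  | .skipAddress e, some true => go (.work (.skipAddress e)) .right same
  | .skipAddress e, some false => go (.work (.skipOperation e)) .right same
  | .skipOperation e, some true => go (.work (.skipOperation e)) .right same
  | .skipOperation e, some false => go (.work (.skip e)) .right same
  | .readAddress, some true => go (.work .readAddress) .right (.bit true, .left)
  | .readAddress, some false => go (.work (.readOperation 0)) .right (σ .addr, .right)
  | .readOperation b, some true => go (.work (.readOperation (b + 1))) .right same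
  | .readOperation b, some false =>
      if h : b.val < operationCount then
        match Operation.code.symm ⟨b.val, h⟩ with
        | .inl v => go (Ctrl.answer v) .stay same
        | .inr (a, m, adv) => (.work .rewind, onInterpTapes (σ .prog, .stay)
            (σ .inp, if adv then .right else .stay) same (.ofOption a, m))
      else go .halt .stay same
  | _, none => go .halt .stay same

/-- A configuration of the interpreter on the word `w`: program head at `p`, input head at `j`,
address register `m`. -/
def interpConfig (w : List Bool) (q : InterpState) (p : ℤ) (j : ℕ) (C : ℤ → TapeSym A)
    (D : ℤ → Option Bool) : ViewConfig InterpState InterpTape A :=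
  (.work q, onInterpTapes (shiftTape (MultitapeTM.wordTape w) p)
    (shiftTape (MultitapeTM.wordTape w) j) C (TapeSym.ofOption ∘ D))

/-- The address register holding `m`. -/
def addressTape (m : ℕ) : ℤ → TapeSym A := splitTape [] (List.replicate m (.bit true))

/-- The address register while it is being loaded: the head is left of the `m` marks. -/
def loadingTape (m : ℕ) : ℤ → TapeSym A := splitTape [] (.blank :: List.replicate m (.bit true))

theorem loadingTape_zero : (loadingTape 0 : ℤ → TapeSym A) = addressTape 0 :=
  splitTape_right_default []

theorem act_loadingTape_left (m : ℕ) :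
    act (loadingTape m) (.bit true) .left = (loadingTape (m + 1) : ℤ → TapeSym A) := by
  simp [loadingTape, act_splitTape_left, List.replicate_succ, TapeSym.default_eq]

theorem act_loadingTape_right (m : ℕ) :
    act (loadingTape m) .blank .right = (addressTape m : ℤ → TapeSym A) := by
  rw [loadingTape, act_splitTape_right, addressTape]
  exact splitTape_left_default _

theorem act_addressTape_right (m : ℕ) :
    act (addressTape (m + 1)) .blank .right = (addressTape m : ℤ → TapeSym A) := by
  rw [addressTape, act_splitTape_right, addressTape]
  exact splitTape_left_default _

theorem viewStep_interpConfig {w : List Bool} {q : InterpState} {p : ℤ} {j : ℕ}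
    {C : ℤ → TapeSym A} {D : ℤ → Option Bool} {s : Ctrl InterpState} {m : HeadMove} {adv : Bool}
    {a : TapeSym A × HeadMove} {d : Option Bool} {md : HeadMove}
    (h : interpTrans q (onInterpTapes (MultitapeTM.wordTape w p) (MultitapeTM.wordTape w j)
        (C 0) (.ofOption (D 0))) =
      (s, onInterpTapes (MultitapeTM.wordTape w p, m)
        (MultitapeTM.wordTape w j, if adv then .right else .stay) a (.ofOption d, md))) :
    viewStep interpTrans (interpConfig w q p j C D) =
      (s, (interpConfig w q (p + m.toInt) (if adv then j + 1 else j) (act C a.1 a.2)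
        (act D d md)).2) := by
  have e : (fun i => (interpConfig w q p j C D).2 i 0) =
      onInterpTapes (MultitapeTM.wordTape w p) (MultitapeTM.wordTape w j)
        (C 0) (TapeSym.ofOption (D 0)) := by
    funext i
    cases i <;> simp [interpConfig, onInterpTapes]
  have e' : interpConfig w q p j C D = (.work q, (interpConfig w q p j C D).2) := rfl
  rw [e', viewStep_work, e, h]
  refine Prod.ext rfl (funext fun i => ?_)
  cases i
  · simp only [interpConfig, onInterpTapes, act_shiftTape]
  · simp only [interpConfig, onInterpTapes, act_shiftTape]
    cases adv <;> simp [HeadMove.toInt]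
  · rfl
  · simp only [interpConfig, onInterpTapes, act_comp]

theorem viewStep_interpConfig_go {w : List Bool} {q q' : InterpState} {p : ℤ} {j : ℕ}
    {C : ℤ → TapeSym A} {D : ℤ → Option Bool} {m : HeadMove}
    {a : TapeSym A × HeadMove}
    (h : interpTrans q (onInterpTapes (MultitapeTM.wordTape w p) (MultitapeTM.wordTape w j)
        (C 0) (.ofOption (D 0))) =
      (.work q', onInterpTapes (MultitapeTM.wordTape w p, m)
        (MultitapeTM.wordTape w j, .stay) a (.ofOption (D 0), .stay))) :
    viewStep interpTrans (interpConfig w q p j C D) =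
      interpConfig w q' (p + m.toInt) j (act C a.1 a.2) D := by
  rw [viewStep_interpConfig (adv := false) h, act_stay_self]
  rfl

/-! ### The phases of one interpreter cycle -/

section Steps

variable (w : List Bool) (j : ℕ) (C : ℤ → TapeSym A) (D : ℤ → Option Bool)

theorem interp_rewind_step {p : ℕ} (hp : p < w.length) :
    viewStep interpTrans (interpConfig w .rewind p j C D) =
      interpConfig w .rewind (p - 1 : ℤ) j C D := by
  have h : (MultitapeTM.wordTape w (p : ℤ) : TapeSym A).toOption = some w[p] := by
    rw [MultitapeTM.toOption_wordTape]; simp [hp]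
  rw [viewStep_interpConfig_go (q' := .rewind) (m := .left) (a := (C 0, .stay)), act_stay_self]
  · rfl
  · simp only [interpTrans, onInterpTapes, h]

theorem interp_rewind {p : ℕ} (hp : p ≤ w.length) :
    (viewStep interpTrans)^[p] (interpConfig w .rewind (p - 1 : ℤ) j C D) =
      interpConfig w .rewind (-1) j C D := by
  induction p with
  | zero => rfl
  | succ p ih =>
    rw [Function.iterate_succ_apply]
    have : ((p + 1 : ℕ) : ℤ) - 1 = (p : ℕ) := by push_cast; ring
    rw [this, interp_rewind_step w j C D hp]
    exact ih (by omega)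

theorem interp_rewind_end :
    viewStep interpTrans (interpConfig w .rewind (-1) j C D) =
      interpConfig w (.skip (symbolIndex w[j]? (D 0)).castSucc) 0 j C D := by
  rw [viewStep_interpConfig_go (q' := .skip (symbolIndex w[j]? (D 0)).castSucc) (m := .right)
    (a := (C 0, .stay)), act_stay_self]
  · rfl
  · have h : (MultitapeTM.wordTape w (-1) : TapeSym A).toOption = none := rfl
    simp only [interpTrans, onInterpTapes, h, MultitapeTM.toOption_wordTape,
      TapeSym.toOption_ofOption]

/-- Scanning a unary number: a state that moves right over ones, keeping everything else. -/
theorem interp_scan {q q' : InterpState} {a : ℕ} {p : ℕ} {rest : List Bool}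
    (h1 : ∀ p : ℕ, w[p]? = some true → viewStep interpTrans (interpConfig w q p j C D) =
      interpConfig w q (p + 1 : ℕ) j C D)
    (h0 : ∀ p : ℕ, w[p]? = some false → viewStep interpTrans (interpConfig w q p j C D) =
      interpConfig w q' (p + 1 : ℕ) j C D)
    (hw : w.drop p = List.replicate a true ++ false :: rest) :
    (viewStep interpTrans)^[a + 1] (interpConfig w q p j C D) =
      interpConfig w q' (p + a + 1 : ℕ) j C D := by
  induction a generalizing p with
  | zero =>
    have : w[p]? = some false := by
      rw [← List.head?_drop, hw]; rfl
    simpa using h0 p this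
  | succ a ih =>
    have : w[p]? = some true := by
      rw [← List.head?_drop, hw]; rfl
    rw [Function.iterate_succ_apply, h1 p this, ih]
    · congr 2; ring
    · rw [← List.drop_drop, hw]; rfl

theorem interp_skipAddress_step (e : Fin 10) {p : ℕ} {b : Bool} (hp : w[p]? = some b) :
    viewStep interpTrans (interpConfig w (.skipAddress e) p j C D) =
      interpConfig w (if b then .skipAddress e else .skipOperation e) (p + 1 : ℕ) j C D := by
  have h : (MultitapeTM.wordTape w (p : ℤ) : TapeSym A).toOption = some b := by
    rw [MultitapeTM.toOption_wordTape, hp]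
  rw [viewStep_interpConfig_go (q' := if b then .skipAddress e else .skipOperation e) (m := .right)
    (a := (C 0, .stay)), act_stay_self]
  · rfl
  · cases b <;> simp [interpTrans, onInterpTapes, h]

theorem interp_skipOperation_step (e : Fin 10) {p : ℕ} {b : Bool} (hp : w[p]? = some b) :
    viewStep interpTrans (interpConfig w (.skipOperation e) p j C D) =
      interpConfig w (if b then .skipOperation e else .skip e) (p + 1 : ℕ) j C D := by
  have h : (MultitapeTM.wordTape w (p : ℤ) : TapeSym A).toOption = some b := by
    rw [MultitapeTM.toOption_wordTape, hp]
  rw [viewStep_interpConfig_go (q' := if b then .skipOperation e else .skip e) (m := .right)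
    (a := (C 0, .stay)), act_stay_self]
  · rfl
  · cases b <;> simp [interpTrans, onInterpTapes, h]

/-- Skipping one instruction. -/
theorem interp_skipEntry (e : Fin 10) {p : ℕ} {r : ℕ × Operation} {rest : List Bool}
    (hw : w.drop p = encodeEntry r ++ rest) :
    (viewStep interpTrans)^[(encodeEntry r).length] (interpConfig w (.skipAddress e) p j C D) =
      interpConfig w (.skip e) (p + (encodeEntry r).length : ℕ) j C D := by
  have hlen : (encodeEntry r).length = ((Operation.code r.2).val + 1) + (r.1 + 1) := by
    simp [encodeEntry]; ring
  have hw' : w.drop p = List.replicate r.1 true ++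
      false :: (List.replicate (Operation.code r.2) true ++ false :: rest) := by
    rw [hw]; simp [encodeEntry]
  rw [hlen, Function.iterate_add_apply, interp_scan w j C D (q' := .skipOperation e)
    (fun p hp => interp_skipAddress_step w j C D e hp)
    (fun p hp => interp_skipAddress_step w j C D e hp) hw',
    interp_scan w j C D (q' := .skip e) (rest := rest)
    (fun p hp => interp_skipOperation_step w j C D e hp)
    (fun p hp => interp_skipOperation_step w j C D e hp)]
  · congr 2; ring
  · have : w.drop (p + r.1 + 1) = (w.drop p).drop (r.1 + 1) := by rw [List.drop_drop]; congr 1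
    rw [this, hw']
    simp [List.drop_append]

theorem interp_skip_succ {e : Fin 10} (he : e ≠ 0) (p : ℤ) :
    viewStep interpTrans (interpConfig w (.skip e) p j C D) =
      interpConfig w (.skipAddress (e - 1)) p j C D := by
  rw [viewStep_interpConfig_go (q' := .skipAddress (e - 1)) (m := .stay)
    (a := (C 0, .stay)), act_stay_self]
  · simp [HeadMove.toInt]
  · simp [interpTrans, onInterpTapes, he]

/-- The register is consumed while it is used: each erased mark pays for one skipped instruction.
The instruction found at the end loads it afresh. -/
theorem interp_skip_pop (m : ℕ) (p : ℤ) :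
    viewStep interpTrans (interpConfig w (.skip 0) p j (addressTape (m + 1) : ℤ → TapeSym A) D) =
      interpConfig w (.skipAddress 0) p j (addressTape m) D := by
  rw [viewStep_interpConfig_go (q' := .skipAddress 0) (m := .stay)
    (a := (.blank, .right)), act_addressTape_right]
  · simp [HeadMove.toInt]
  · simp [interpTrans, onInterpTapes, addressTape, List.replicate_succ, TapeSym.toOption]

theorem interp_skip_zero (p : ℤ) :
    viewStep interpTrans (interpConfig w (.skip 0) p j (addressTape 0 : ℤ → TapeSym A) D) =
      interpConfig w .readAddress p j (loadingTape 0) D := by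
  rw [viewStep_interpConfig_go (q' := .readAddress) (m := .stay)
    (a := ((addressTape 0 : ℤ → TapeSym A) 0, .stay)), act_stay_self, loadingTape_zero]
  · simp [HeadMove.toInt]
  · simp [interpTrans, onInterpTapes, addressTape, TapeSym.default_eq, TapeSym.toOption]

/-- Marks are written leftwards while the program head moves right, so loading takes one pass; the
closing `0` moves the register head back onto the first mark. -/
theorem interp_readAddress {a : ℕ} {p m : ℕ} {rest : List Bool}
    (hw : w.drop p = List.replicate a true ++ false :: rest) :
    (viewStep interpTrans)^[a + 1]
      (interpConfig w .readAddress p j (loadingTape m : ℤ → TapeSym A) D) =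
      interpConfig w (.readOperation 0) (p + a + 1 : ℕ) j (addressTape (m + a)) D := by
  induction a generalizing p m with
  | zero =>
    have : w[p]? = some false := by
      rw [← List.head?_drop, hw]; rfl
    have h : (MultitapeTM.wordTape w (p : ℤ) : TapeSym A).toOption = some false := by
      rw [MultitapeTM.toOption_wordTape, this]
    rw [Function.iterate_one, viewStep_interpConfig_go (q' := .readOperation 0) (m := .right)
      (a := (.blank, .right)), act_loadingTape_right]
    · rfl
    · simp [interpTrans, onInterpTapes, h, loadingTape]
  | succ a ih =>
    have : w[p]? = some true := by
      rw [← List.head?_drop, hw]; rfl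
    have h : (MultitapeTM.wordTape w (p : ℤ) : TapeSym A).toOption = some true := by
      rw [MultitapeTM.toOption_wordTape, this]
    rw [Function.iterate_succ_apply, viewStep_interpConfig_go (q' := .readAddress) (m := .right)
      (a := (.bit true, .left)), act_loadingTape_left]
    · have hp : (p : ℤ) + HeadMove.right.toInt = ((p + 1 : ℕ) : ℤ) := by simp [HeadMove.toInt]
      rw [hp, ih]
      · congr 2 <;> ring
      · rw [← List.drop_drop, hw]; rfl
    · simp [interpTrans, onInterpTapes, h]

theorem interp_readOperation {a b : ℕ} {p : ℕ} {rest : List Bool}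
    (hb : b + a < operationCount + 1)
    (hw : w.drop p = List.replicate a true ++ false :: rest) :
    (viewStep interpTrans)^[a]
      (interpConfig w (.readOperation ⟨b, by omega⟩) p j C D) =
      interpConfig w (.readOperation ⟨b + a, hb⟩) (p + a : ℕ) j C D := by
  induction a generalizing p b with
  | zero => rfl
  | succ a ih =>
    have : w[p]? = some true := by
      rw [← List.head?_drop, hw]; rfl
    have h : (MultitapeTM.wordTape w (p : ℤ) : TapeSym A).toOption = some true := by
      rw [MultitapeTM.toOption_wordTape, this]
    have hb1 : (⟨b, by omega⟩ + 1 : Fin (operationCount + 1)) = ⟨b + 1, by omega⟩ := by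
      apply Fin.ext
      rw [Fin.val_add_one_of_lt]
      rw [Fin.lt_def, Fin.val_last]; dsimp only; omega
    rw [Function.iterate_succ_apply, viewStep_interpConfig_go
      (q' := .readOperation ⟨b + 1, by omega⟩) (m := .right)
      (a := (C 0, .stay)), act_stay_self]
    · have hp : (p : ℤ) + HeadMove.right.toInt = ((p + 1 : ℕ) : ℤ) := by simp [HeadMove.toInt]
      rw [hp, ih (b := b + 1) (by omega)]
      · congr 1
        · exact congrArg _ (Fin.ext (by dsimp only; omega))
        · push_cast; ring
      · rw [← List.drop_drop, hw]; rfl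
    · simp [interpTrans, onInterpTapes, h, hb1]

/-- The number of instructions to skip is split between the finite control (`e`, from the scanned
symbols) and the register (`m`, from the state). The control is exhausted first; each instruction
costs its length plus one step for the decision to skip it. -/
theorem interp_skipTable (rs : List (ℕ × Operation)) {e : Fin 10} {m p : ℕ} {rest : List Bool}
    (hrs : rs.length = e + m) (hw : w.drop p = encodeTable rs ++ rest) :
    (viewStep interpTrans)^[(encodeTable rs).length + rs.length]
      (interpConfig w (.skip e) p j (addressTape m : ℤ → TapeSym A) D) =
      interpConfig w (.skip 0) (p + (encodeTable rs).length : ℕ) j (addressTape 0) D := by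
  induction rs generalizing e m p with
  | nil =>
    have he : e = 0 := Fin.ext (by simp at hrs; simp; omega)
    have hm : m = 0 := by simp at hrs; omega
    subst he hm
    simp [encodeTable]
  | cons r rs ih =>
    have hlen : (encodeTable (r :: rs)).length = (encodeEntry r).length + (encodeTable rs).length := by
      simp [encodeTable]
    have hw1 : w.drop p = encodeEntry r ++ (encodeTable rs ++ rest) := by
      rw [hw]; simp [encodeTable]
    have hw2 : w.drop (p + (encodeEntry r).length) = encodeTable rs ++ rest := by
      rw [← List.drop_drop, hw1, List.drop_left]
    have hsteps : (encodeTable (r :: rs)).length + (r :: rs).length =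
        ((encodeTable rs).length + rs.length) + ((encodeEntry r).length + 1) := by
      rw [hlen]; simp; ring
    have hend : p + (encodeTable (r :: rs)).length =
        p + (encodeEntry r).length + (encodeTable rs).length := by rw [hlen]; ring
    rw [hsteps, hend, Function.iterate_add_apply, Function.iterate_succ_apply]
    by_cases he : e = 0
    · obtain ⟨m, rfl⟩ : ∃ m', m = m' + 1 := ⟨m - 1, by simp [he] at hrs; omega⟩
      subst he
      rw [interp_skip_pop, interp_skipEntry w j _ D 0 hw1]
      exact ih (by simp at hrs ⊢; omega) hw2
    · rw [interp_skip_succ w j _ D he, interp_skipEntry w j _ D _ hw1]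
      refine ih ?_ hw2
      have h1 : ∀ e : Fin 10, e ≠ 0 → (e - 1).val + 1 = e.val := by decide
      have := h1 e he
      simp at hrs
      omega

theorem interp_execute {r : ℕ × Operation} {p : ℕ}
    (hp : w[p]? = some false) :
    (∀ v, r.2 = .inl v → (viewStep interpTrans (interpConfig w
      (.readOperation (Operation.code r.2).castSucc) p j C D)).1 = Ctrl.answer v) ∧
    ∀ a m adv, r.2 = .inr (a, m, adv) → viewStep interpTrans (interpConfig w
      (.readOperation (Operation.code r.2).castSucc) p j C D) =
        interpConfig w .rewind p (if adv then j + 1 else j) C (act D a m) := by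
  have h : (MultitapeTM.wordTape w (p : ℤ) : TapeSym A).toOption = some false := by
    rw [MultitapeTM.toOption_wordTape, hp]
  constructor
  · intro v hv
    rw [viewStep_interpConfig (s := Ctrl.answer v) (adv := false) (m := .stay)
      (a := (C 0, .stay)) (d := D 0) (md := .stay)]
    simp only [interpTrans, onInterpTapes, h, Fin.val_castSucc, Fin.is_lt, dite_true, Fin.eta,
      Equiv.symm_apply_apply, hv]
    rfl
  · intro a m adv hr
    rw [viewStep_interpConfig (s := .work .rewind) (adv := adv) (m := .stay)
      (a := (C 0, .stay)) (d := a) (md := m), act_stay_self]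
    · simp [interpConfig, HeadMove.toInt]
    · simp only [interpTrans, onInterpTapes, h, Fin.val_castSucc, Fin.is_lt, dite_true, Fin.eta,
        Equiv.symm_apply_apply, hr]

end Steps

theorem length_le_length_encodeTable (tab : List (ℕ × Operation)) :
    tab.length ≤ (encodeTable tab).length := by
  induction tab with
  | nil => simp
  | cons r rs ih =>
    have : 1 ≤ (encodeEntry r).length := by simp [encodeEntry]; omega
    simp [encodeTable] at ih ⊢
    omega

/-- The interpreter executes one instruction in time linear in the length of the program. -/
theorem interp_cycle {tab : List (ℕ × Operation)} {w v : List Bool} (hw : w = encodeTable tab ++ v)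
    {m j : ℕ} {D : ℤ → Option Bool} {r : ℕ × Operation}
    (hr : tab[m + symbolIndex w[j]? (D 0)]? = some r) {p : ℕ} (hp : p < (encodeTable tab).length) :
    ∃ t ≤ 4 * (encodeTable tab).length + 4,
      (∀ b, r.2 = .inl b → ((viewStep interpTrans)^[t]
        (interpConfig w .rewind p j (addressTape m : ℤ → TapeSym A) D)).1 = .answer b) ∧
      ∀ a mv adv, r.2 = .inr (a, mv, adv) → ∃ p' < (encodeTable tab).length,
        (viewStep interpTrans)^[t]
          (interpConfig w .rewind p j (addressTape m : ℤ → TapeSym A) D) =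
          interpConfig w .rewind p' (if adv then j + 1 else j) (addressTape r.1) (act D a mv) := by
  set i := m + (symbolIndex w[j]? (D 0)).val with hi
  obtain ⟨hil, hri⟩ := List.getElem?_eq_some_iff.1 hr
  set pre := tab.take i with hpre
  set post := tab.drop (i + 1) with hpost
  have htab : tab = pre ++ r :: post := by
    rw [hpre, hpost, ← hri, ← List.drop_eq_getElem_cons hil, List.take_append_drop]
  have henc : encodeTable tab = encodeTable pre ++ (encodeEntry r ++ encodeTable post) := by
    rw [htab]; simp [encodeTable]
  have hlen := congrArg List.length henc
  simp only [List.length_append] at hlen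
  have hprel : pre.length = i := by rw [hpre, List.length_take]; omega
  have hentry : (encodeEntry r).length = r.1 + (Operation.code r.2).val + 2 := by
    simp [encodeEntry]; ring
  have hpw : p < w.length := by rw [hw, List.length_append]; omega
  set P := (encodeTable pre).length with hP
  have hprele := length_le_length_encodeTable pre
  have hd0 : w.drop 0 = encodeTable pre ++ (encodeEntry r ++ encodeTable post ++ v) := by
    rw [hw, henc]; simp
  have hd1 : w.drop P = List.replicate r.1 true ++
      false :: (List.replicate (Operation.code r.2) true ++ false :: (encodeTable post ++ v)) := by
    have : w.drop P = (w.drop 0).drop P := by simp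
    rw [this, hd0, List.drop_left]
    simp [encodeEntry]
  have hd2 : w.drop (P + r.1 + 1) =
      List.replicate (Operation.code r.2) true ++ false :: (encodeTable post ++ v) := by
    have : w.drop (P + r.1 + 1) = (w.drop P).drop (r.1 + 1) := by rw [List.drop_drop]; congr 1
    rw [this, hd1]
    simp [List.drop_append]
  have hd3 : w[P + r.1 + 1 + (Operation.code r.2).val]? = some false := by
    have : w.drop (P + r.1 + 1 + (Operation.code r.2).val) =
        (w.drop (P + r.1 + 1)).drop (Operation.code r.2).val := by rw [List.drop_drop]
    rw [← List.head?_drop, this, hd2]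
    simp
  -- The summands of the exponent, from right to left: rewind, read the two symbols at cell `-1`,
  -- skip the preceding instructions, notice the empty register, load the next address, count the
  -- operation code.
  have hmain : (viewStep interpTrans)^[(Operation.code r.2).val + ((r.1 + 1) + (1 +
      ((P + pre.length) + (1 + (p + 1)))))]
        (interpConfig w .rewind p j (addressTape m : ℤ → TapeSym A) D) =
      interpConfig w (.readOperation (Operation.code r.2).castSucc)
        (P + r.1 + 1 + (Operation.code r.2).val : ℕ) j (addressTape r.1) D := by
    have h1 := interp_rewind w j (addressTape m : ℤ → TapeSym A) D (p := p + 1) hpw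
    rw [show ((p + 1 : ℕ) : ℤ) - 1 = p by push_cast; ring] at h1
    have h2 := interp_skipTable w j D (A := A) pre (e := (symbolIndex w[j]? (D 0)).castSucc)
      (m := m) (p := 0) (by rw [hprel, hi, Fin.val_castSucc]; ring) hd0
    have h3 := interp_readAddress w j D (A := A) (m := 0) hd1
    have h4 := interp_readOperation w j (addressTape r.1 : ℤ → TapeSym A) D (b := 0)
      (a := (Operation.code r.2).val) (by omega) hd2
    rw [zero_add] at h2 h3
    rw [Nat.cast_zero] at h2
    refine iterate_trans (iterate_trans (iterate_trans (iterate_trans (iterate_trans h1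
      (interp_rewind_end w j _ D)) h2) (interp_skip_zero w j D _)) h3) (h4.trans ?_)
    congr 2
    exact Fin.ext (by simp)
  have hex := interp_execute w j (addressTape r.1 : ℤ → TapeSym A) D (r := r) hd3
  refine ⟨(Operation.code r.2).val + ((r.1 + 1) + (1 + ((P + pre.length) + (1 + (p + 1))))) + 1,
    by omega, fun b hb => ?_, fun a mv adv hop => ?_⟩
  · rw [Function.iterate_succ_apply', hmain]
    exact hex.1 b hb
  · refine ⟨P + r.1 + 1 + (Operation.code r.2).val, by omega, ?_⟩
    rw [Function.iterate_succ_apply', hmain]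
    exact hex.2 a mv adv hop

end Interpreter

/-! ### Programs for machines with one data tape -/

/-- Transition function of a machine that reads its input in one direction and has one data tape:
an answer, or the next state, the symbol written, the move, and whether the input advances. -/
abbrev DataTrans (σ : Type) : Type :=
  σ → Option Bool → Option Bool → Bool ⊕ (σ × Option Bool × HeadMove × Bool)

/-- Answer or state, position on the input, data tape seen from its head. -/
abbrev DataConfig (σ : Type) : Type := (Bool ⊕ σ) × ℕ × (ℤ → Option Bool)

section DataMachine

variable {σ : Type}

/-- One step on the input `w`. -/
def dataStep (w : List Bool) (δ : DataTrans σ) (c : DataConfig σ) : DataConfig σ :=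
  match c.1 with
  | .inl _ => c
  | .inr q =>
    match δ q w[c.2.1]? (c.2.2 0) with
    | .inl b => (.inl b, c.2)
    | .inr (q', a, m, adv) => (.inr q', if adv then c.2.1 + 1 else c.2.1, act c.2.2 a m)

theorem dataStep_inr {w : List Bool} {δ : DataTrans σ} {q q' : σ} {j : ℕ} {D : ℤ → Option Bool}
    {a : Option Bool} {m : HeadMove} {adv : Bool} (h : δ q w[j]? (D 0) = .inr (q', a, m, adv)) :
    dataStep w δ (.inr q, j, D) = (.inr q', if adv then j + 1 else j, act D a m) := by
  simp [dataStep, h]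

theorem symbolIndex_injective : Function.Injective (Function.uncurry symbolIndex) := by
  decide

/-- Every machine with one data tape has a program on which the interpreter simulates it with
constant overhead. -/
theorem exists_table [Finite σ] (δ : DataTrans σ) (q₀ : σ) :
    ∃ tab : List (ℕ × Operation), ∃ Z : ℕ, ∀ (A : Type) (w v : List Bool),
      w = encodeTable tab ++ v → ∀ (t : ℕ) (b : Bool),
        ((dataStep w δ)^[t] (.inr q₀, 0, fun _ => none)).1 = .inl b →
          ∃ t' ≤ Z * t, ((viewStep interpTrans)^[t'] (interpConfig w .rewind 0 0
            (addressTape 0 : ℤ → TapeSym A) fun _ => none)).1 = .answer b := by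
  -- The start state gets number `0` because the interpreter starts with an empty address register.
  obtain ⟨n, e, he⟩ := exists_equiv_fin_map_zero q₀
  -- Each state owns nine consecutive instructions, one for each pair of scanned symbols, whence
  -- base addresses are multiples of `9`.
  let row : Fin (n + 1) × Fin 9 → ℕ × Operation := fun y =>
    match δ (e.symm y.1) (Function.invFun (Function.uncurry symbolIndex) y.2).1
      (Function.invFun (Function.uncurry symbolIndex) y.2).2 with
    | .inl b => (0, .inl b)
    | .inr (q', a, m, adv) => (9 * (e q').val, .inr (a, m, adv))
  let tab : List (ℕ × Operation) :=
    List.ofFn fun i : Fin ((n + 1) * 9) => row (finProdFinEquiv.symm i)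
  have htab : ∀ (q : σ) (x d : Option Bool),
      tab[9 * (e q).val + (symbolIndex x d).val]? = some (row (e q, symbolIndex x d)) := by
    intro q x d
    have h1 : 9 * (e q).val + (symbolIndex x d).val =
        (finProdFinEquiv (e q, symbolIndex x d)).val := by
      simp [finProdFinEquiv, add_comm]
    rw [h1, List.getElem?_ofFn, dif_pos (Fin.is_lt _), Fin.eta, Equiv.symm_apply_apply]
  have hinv : ∀ x d, Function.invFun (Function.uncurry symbolIndex) (symbolIndex x d) = (x, d) :=
    fun x d => Function.leftInverse_invFun symbolIndex_injective (x, d)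
  refine ⟨tab, 4 * (encodeTable tab).length + 4, fun A w v hw t b h => ?_⟩
  have key : ∀ (t : ℕ) (q : σ) (j : ℕ) (D : ℤ → Option Bool) (p : ℕ),
      p < (encodeTable tab).length → ((dataStep w δ)^[t] (.inr q, j, D)).1 = .inl b →
      ∃ t' ≤ (4 * (encodeTable tab).length + 4) * t,
        ((viewStep interpTrans)^[t'] (interpConfig w .rewind p j
          (addressTape (9 * (e q).val) : ℤ → TapeSym A) D)).1 = .answer b := by
    intro t
    induction t with
    | zero => intro q j D p _ h; simp at h
    | succ t ih =>
      intro q j D p hp h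
      obtain ⟨t₁, ht₁, hans, hcont⟩ := interp_cycle (A := A) hw (htab q w[j]? (D 0)) hp
      rw [Function.iterate_succ_apply] at h
      have hrow : row (e q, symbolIndex w[j]? (D 0)) =
          match δ q w[j]? (D 0) with
          | .inl b => (0, .inl b)
          | .inr (q', a, m, adv) => (9 * (e q').val, .inr (a, m, adv)) := by
        simp only [row, hinv, Equiv.symm_apply_apply]
      rw [hrow] at hans hcont
      rcases hδ : δ q w[j]? (D 0) with b' | ⟨q', a, m, adv⟩
      · have h2 : dataStep w δ (.inr q, j, D) = (.inl b', j, D) := by simp [dataStep, hδ]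
        have h3 : (dataStep w δ)^[t] (.inl b', j, D) = (.inl b', j, D) :=
          Function.iterate_fixed rfl t
        rw [h2, h3] at h
        obtain rfl : b' = b := by simpa using h
        refine ⟨t₁, ht₁.trans (Nat.le_mul_of_pos_right _ (by omega)), hans b' ?_⟩
        rw [hδ]
      · rw [dataStep_inr hδ] at h
        obtain ⟨p', hp', hc⟩ := hcont a m adv (by rw [hδ])
        rw [hδ] at hc
        obtain ⟨t₂, ht₂, hf⟩ := ih _ _ _ p' hp' h
        refine ⟨t₂ + t₁, by rw [mul_add, mul_one]; omega, ?_⟩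
        rw [iterate_trans hc rfl]
        exact hf
  have hpos : 0 < (encodeTable tab).length :=
    lt_of_lt_of_le (by simp [tab]) (length_le_length_encodeTable tab)
  have := key t q₀ 0 (fun _ => none) 0 hpos h
  rwa [he] at this

end DataMachine

/-! ### Simulating several tapes by sweeps over one tape -/

instance (M : MultitapeTM) : Finite M.Q := M.finite_Q

instance (M : MultitapeTM) : Finite M.A := M.finite_A

instance {A : Type} [Finite A] : Finite (TapeSym A) :=
  Finite.of_surjective (fun x : Option (Bool ⊕ A) => match x with
    | none => TapeSym.blank
    | some (.inl b) => .bit b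
    | some (.inr a) => .aux a) (by
    rintro (_ | b | a)
    exacts [⟨none, rfl⟩, ⟨some (.inl b), rfl⟩, ⟨some (.inr a), rfl⟩])

/-- A block of bits, one for each track. -/
abbrev Block (K : ℕ) : Type := Fin (K + 1) → Bool

/-! ### Shifting tracks in a sequence of blocks -/

section Blocks

variable {K : ℕ}

/-- The block written over `b` when the bits of the buffer `κ` replace those selected by `mk`. -/
def mixBlock (mk κ b : Block K) : Block K := fun m => if mk m then κ m else b m

/-- The buffer after this replacement. -/
def carryBlock (mk κ b : Block K) : Block K := fun m => if mk m then b m else κ m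

/-- A sequence of blocks with the tracks selected by `mk` delayed by one block, and the buffer. -/
def delayBlocks (mk : Block K) : Block K → List (Block K) → List (Block K) × Block K
  | κ, [] => ([], κ)
  | κ, b :: l => (mixBlock mk κ b :: (delayBlocks mk (carryBlock mk κ b) l).1,
      (delayBlocks mk (carryBlock mk κ b) l).2)

/-- The cells holding a sequence of blocks. -/
def blockCells (l : List (Block K)) : List (Option Bool) :=
  l.flatMap fun b => List.ofFn fun i => some (b i)

/-- The same sequence read backwards. -/
def mirrorBlocks (l : List (Block K)) : List (Block K) := l.reverse.map fun b i => b i.rev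

/-- The bit in block `p`, track `m`. -/
def blockBit (l : List (Block K)) (p : ℕ) (m : Fin (K + 1)) : Bool := l.getD p (fun _ => false) m

theorem delayBlocks_length (mk κ : Block K) (l : List (Block K)) :
    (delayBlocks mk κ l).1.length = l.length := by
  induction l generalizing κ with
  | nil => rfl
  | cons b l ih => simp [delayBlocks, ih]

theorem delayBlocks_append_singleton (mk κ : Block K) (l : List (Block K)) (b : Block K) :
    delayBlocks mk κ (l ++ [b]) =
      ((delayBlocks mk κ l).1 ++ [mixBlock mk (delayBlocks mk κ l).2 b],
        carryBlock mk (delayBlocks mk κ l).2 b) := by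
  induction l generalizing κ with
  | nil => rfl
  | cons b' l ih => simp [delayBlocks, ih]

theorem ofFn_reverse {α : Type} {n : ℕ} (f : Fin n → α) :
    (List.ofFn f).reverse = List.ofFn fun i => f i.rev := by
  apply List.ext_getElem
  · simp
  · intro i h1 h2
    simp only [List.getElem_reverse, List.getElem_ofFn, List.length_ofFn]
    congr 1
    apply Fin.ext
    simp [Fin.val_rev]
    omega

theorem ofFn_drop_eq_cons {α : Type} {n : ℕ} (f : Fin n → α) {m : ℕ} (h : m < n) :
    (List.ofFn f).drop m = f ⟨m, h⟩ :: (List.ofFn f).drop (m + 1) := by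
  rw [List.drop_eq_getElem_cons (by simpa using h), List.getElem_ofFn]

theorem ofFn_take_succ {α : Type} {n : ℕ} (f : Fin n → α) {m : ℕ} (h : m < n) :
    (List.ofFn f).take (m + 1) = (List.ofFn f).take m ++ [f ⟨m, h⟩] := by
  rw [List.take_succ_eq_append_getElem (by simpa using h), List.getElem_ofFn]

theorem ofFn_drop_last {α : Type} {n : ℕ} (f : Fin (n + 1) → α) :
    (List.ofFn f).drop n = [f (Fin.last n)] := by
  rw [ofFn_drop_eq_cons f (Nat.lt_succ_self n), List.drop_of_length_le (by simp)]
  rfl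

theorem ofFn_eq_take_append_last {α : Type} {n : ℕ} (f : Fin (n + 1) → α) :
    List.ofFn f = (List.ofFn f).take n ++ [f (Fin.last n)] := by
  rw [← ofFn_drop_last, List.take_append_drop]

theorem blockCells_reverse (l : List (Block K)) :
    (blockCells l).reverse = blockCells (mirrorBlocks l) := by
  induction l with
  | nil => rfl
  | cons b l ih =>
    simp only [blockCells, mirrorBlocks, List.flatMap_cons, List.reverse_append, List.reverse_cons,
      List.map_append, List.flatMap_append] at ih ⊢
    rw [ih, ofFn_reverse]
    simp

/-- The appended zero block catches what is shifted out of the last block, so nothing is lost: on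
the selected tracks the sweep is a push of the buffer. -/
theorem blockBit_delayBlocks (mk κ : Block K) (l : List (Block K)) (p : ℕ) (m : Fin (K + 1)) :
    blockBit (delayBlocks mk κ (l ++ [fun _ => false])).1 p m =
      if mk m then (if p = 0 then κ m else blockBit l (p - 1) m) else blockBit l p m := by
  induction l generalizing κ p with
  | nil =>
    rcases p with _ | p
    · simp [delayBlocks, blockBit, mixBlock]
    · simp [delayBlocks, blockBit]
  | cons b l ih =>
    rcases p with _ | p
    · simp [delayBlocks, blockBit, mixBlock]
    · have h := ih (carryBlock mk κ b) p
      simp only [blockBit, List.cons_append, delayBlocks, List.getD_cons_succ] at h ⊢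
      rw [h]
      by_cases hm : mk m
      · rcases p with _ | p <;> simp [hm, carryBlock]
      · simp [hm]

/-- Delaying a sequence read backwards advances it: on the selected tracks every block receives the
bit of its successor and the first bit ends up in the buffer, which is a pop. The two claims need a
joint induction, as the buffer left by the tail is what is written into the first block. The index
`m.rev` appears because the tracks within a block are also met in reverse. -/
theorem blockBit_delayBlocks_mirror (mk : Block K) (l : List (Block K)) (m : Fin (K + 1)) :
    (∀ p, blockBit (mirrorBlocks (delayBlocks mk (fun _ => false) (mirrorBlocks l)).1) p m =
      if mk m.rev then blockBit l (p + 1) m else blockBit l p m) ∧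
    (delayBlocks mk (fun _ => false) (mirrorBlocks l)).2 m.rev =
      (mk m.rev && blockBit l 0 m) := by
  induction l with
  | nil => simp [mirrorBlocks, delayBlocks, blockBit]
  | cons b l ih =>
    have h1 : mirrorBlocks (b :: l) = mirrorBlocks l ++ [fun i => b i.rev] := by
      simp [mirrorBlocks]
    rw [h1, delayBlocks_append_singleton]
    constructor
    · intro p
      rcases p with _ | p
      · simp only [mirrorBlocks, List.reverse_append, List.reverse_cons, List.reverse_nil,
          List.nil_append, List.singleton_append, List.map_cons, blockBit, List.getD_cons_zero,
          mixBlock, Fin.rev_rev, List.getD_cons_succ]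
        have := ih.2
        simp only [blockBit, mirrorBlocks] at this
        rw [this]
        by_cases hm : mk m.rev <;> simp [hm]
      · have h := ih.1 p
        simp only [blockBit] at h ⊢
        rw [List.getD_cons_succ, List.getD_cons_succ, ← h]
        simp [mirrorBlocks]
    · simp only [carryBlock, Fin.rev_rev, ih.2]
      by_cases hm : mk m.rev <;> simp [hm, blockBit]

theorem sweepTape_true_replicate {Γ : Type} [Inhabited Γ] (P : List Γ) (n : ℕ) :
    sweepTape true P (List.replicate n default) = sweepTape true P [] := by
  induction n with
  | zero => rfl
  | succ n ih =>
    rw [List.replicate_succ']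
    exact (splitTape_append_default P _).trans ih

end Blocks

namespace MultitapeTM

/-- The symbol marked by a track in one-hot encoding. -/
noncomputable def decodeTrack {G : Type} (u : G → Bool) : Option G :=
  open Classical in if h : ∃ g, u g = true then some h.choose else none

theorem decodeTrack_eq {G : Type} {u : G → Bool} {o : Option G}
    (h : ∀ g, u g = true ↔ o = some g) : decodeTrack u = o := by
  unfold decodeTrack
  split_ifs with hu
  · exact ((h _).1 hu.choose_spec).symm
  · rcases o with _ | g
    · rfl
    · exact absurd ⟨g, (h g).2 rfl⟩ hu

/-- Whether a move pushes the symbol left behind onto the stack on the given side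
(`true` is the right side). -/
def pushes : HeadMove → Bool → Bool
  | .left, true => true
  | .right, false => true
  | _, _ => false

/-- Whether a move pops the scanned symbol from the stack on the given side. -/
def pops (m : HeadMove) (side : Bool) : Bool := pushes m !side

/-- The symbols written and the moves made in a step. -/
abbrev Actions (M : MultitapeTM) : Type := Fin (M.k + 1) → TapeSym M.A × HeadMove

/-- The tracks: the two stacks of each tape, in one-hot encoding. -/
abbrev Track (M : MultitapeTM) : Type := Fin (M.k + 1) × Bool × TapeSym M.A

/-- States of the sweeping machine: sweeping with a buffer, at a given track, or turning back. -/
inductive SweepState (M : MultitapeTM) (K : ℕ) : Type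
  | pass (d : Bool) (q : M.Q) (a : M.Actions) (κ : Block K) (m : Fin (K + 1))
  | turn (q : M.Q) (a : M.Actions)

instance (M : MultitapeTM) (K : ℕ) : Finite (M.SweepState K) :=
  Finite.of_surjective
    (fun x : (Bool × M.Q × M.Actions × Block K × Fin (K + 1)) ⊕ (M.Q × M.Actions) => match x with
      | .inl (d, q, a, κ, m) => SweepState.pass d q a κ m
      | .inr (q, a) => .turn q a) (by
    rintro (⟨d, q, a, κ, m⟩ | ⟨q, a⟩)
    exacts [⟨.inl (d, q, a, κ, m), rfl⟩, ⟨.inr (q, a), rfl⟩])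

/-! ### The sweeping machine -/

section Sweep

variable (M : MultitapeTM) {K : ℕ} (e : M.Track ≃ Fin (K + 1))

/-- The tracks shifted during a sweep to the right (pushes) or to the left (pops). -/
def sweepMask (d : Bool) (a : M.Actions) : Block K := fun m =>
  if d then pushes (a (e.symm m).1).2 (e.symm m).2.1
  else pops (a (e.symm m.rev).1).2 (e.symm m.rev).2.1

/-- The symbol popped into the buffer from a stack, if there is one. -/
noncomputable def poppedSym (κ : Block K) (i : Fin (M.k + 1)) (side : Bool) :
    Option (TapeSym M.A) :=
  decodeTrack fun g => κ (e (i, side, g)).rev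

/-- The symbols scanned after the actions `a`, from the buffer of popped symbols and the next
input letter. -/
noncomputable def scannedSym (a : M.Actions) (κ : Block K) (x : Option Bool) (i : Fin (M.k + 1)) :
    TapeSym M.A :=
  match (a i).2 with
  | .stay => (a i).1
  | .left => (M.poppedSym e κ i false).getD .blank
  | .right => (M.poppedSym e κ i true).getD (if i = 0 then .ofOption x else .blank)

/-- Whether an input letter is consumed. -/
noncomputable def readsInput (a : M.Actions) (κ : Block K) : Bool :=
  match (a 0).2 with
  | .right => (M.poppedSym e κ 0 true).isNone
  | _ => false

/-- The buffer of the symbols to be pushed. -/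
noncomputable def pushBuffer (a : M.Actions) : Block K := fun m =>
  open Classical in decide ((a (e.symm m).1).1 = (e.symm m).2.2)

/-- The sweeping machine simulating `M` and answering the opposite. -/
noncomputable def sweepTrans : DataTrans (M.SweepState K)
  | .turn q a, _, _ => .inr (.pass false q a (fun _ => false) 0, none, .left, false)
  | .pass d q a κ m, x, c =>
    -- A blank met on the way left marks the home position. A blank met on the way right belongs to
    -- a new block, and `getD false` reads it as `0`.
    if d = false ∧ c = none then
      match M.δ q (M.scannedSym e a κ x) with
      | (.work q', a') =>
          .inr (.pass true q' a' (M.pushBuffer e a') 0, none, .right, M.readsInput e a κ)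
      | (.no, _) => .inl true
      | _ => .inl false
    else
      .inr (if m = Fin.last K then
          (if c = none then .turn q a
            else .pass d q a (fun i => if i = m ∧ M.sweepMask e d a i then c.getD false else κ i) 0)
        else .pass d q a (fun i => if i = m ∧ M.sweepMask e d a i then c.getD false else κ i)
          (m + 1),
        some (if M.sweepMask e d a m then κ m else c.getD false), sweepMove d, false)

variable {M} (w : List Bool) (j : ℕ)

theorem sweep_pass_step {d : Bool} (q : M.Q) (a : M.Actions) (κ : Block K) (m : Fin (K + 1))
    (P R : List (Option Bool)) (c : Option Bool) (hc : d = true ∨ c ≠ none) :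
    dataStep w (M.sweepTrans e) (.inr (.pass d q a κ m), j, sweepTape d P (c :: R)) =
      (.inr (if m = Fin.last K then
          (if c = none then .turn q a
            else .pass d q a (fun i => if i = m ∧ M.sweepMask e d a i then c.getD false else κ i) 0)
        else .pass d q a (fun i => if i = m ∧ M.sweepMask e d a i then c.getD false else κ i)
          (m + 1)), j,
        sweepTape d (some (if M.sweepMask e d a m then κ m else c.getD false) :: P) R) := by
  have h : ¬ (d = false ∧ c = none) := by
    rintro ⟨rfl, rfl⟩; simp at hc
  rw [dataStep_inr (adv := false)
    (a := some (if M.sweepMask e d a m then κ m else c.getD false)) (m := sweepMove d)]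
  rotate_left
  · simp only [sweepTrans, sweepTape_zero, List.headD_cons]
    rw [if_neg h]
  · rw [act_sweepTape]; rfl

/-- The invariant within a block: on the tracks already passed, the selected buffer bits have been
exchanged with the cells. Blank cells are admitted on the way right so that the same invariant
covers the creation of a block. -/
theorem sweep_pass_iterate {d : Bool} (q : M.Q) (a : M.Actions) (κ : Block K)
    (P R : List (Option Bool)) (c : Fin (K + 1) → Option Bool) (hc : d = true ∨ ∀ i, c i ≠ none)
    {n : ℕ} (hn : n < K + 1) :
    (dataStep w (M.sweepTrans e))^[n]
      (.inr (.pass d q a κ 0), j, sweepTape d P (List.ofFn c ++ R)) =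
      (.inr (.pass d q a
        (fun i => if i.val < n ∧ M.sweepMask e d a i then (c i).getD false else κ i) ⟨n, hn⟩), j,
        sweepTape d (((List.ofFn fun i => some (mixBlock (M.sweepMask e d a) κ
          (fun i => (c i).getD false) i)).take n).reverse ++ P) ((List.ofFn c).drop n ++ R)) := by
  induction n with
  | zero => simp
  | succ n ih =>
    have hn' : n < K + 1 := by omega
    rw [Function.iterate_succ_apply', ih hn']
    have hlast : (⟨n, hn'⟩ : Fin (K + 1)) ≠ Fin.last K := by
      intro h
      have := congrArg Fin.val h
      simp at this
      omega
    have hsucc : (⟨n, hn'⟩ + 1 : Fin (K + 1)) = ⟨n + 1, hn⟩ := by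
      apply Fin.ext
      rw [Fin.val_add_one_of_lt]
      rw [Fin.lt_def, Fin.val_last]; dsimp only; omega
    rw [ofFn_drop_eq_cons c hn', List.cons_append, sweep_pass_step e w j q a _ _ _ _ _ (hc.imp id fun h => h _),
      if_neg hlast, hsucc, ofFn_take_succ _ hn']
    refine Prod.ext ?_ (Prod.ext rfl ?_)
    · dsimp only
      congr 2
      funext i
      by_cases hi : i = ⟨n, hn'⟩
      · subst hi
        by_cases hm : M.sweepMask e d a ⟨n, hn'⟩ <;> simp [hm]
      · have : i.val ≠ n := fun h => hi (Fin.ext h)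
        by_cases hm : M.sweepMask e d a i <;> simp [hm, hi]
        by_cases h : i.val < n
        · rw [if_pos h, if_pos (by omega)]
        · rw [if_neg h, if_neg (by omega)]
    · dsimp only
      simp [mixBlock]

theorem sweep_block {d : Bool} (q : M.Q) (a : M.Actions) (κ b : Block K)
    (P R : List (Option Bool)) :
    (dataStep w (M.sweepTrans e))^[K + 1]
      (.inr (.pass d q a κ 0), j, sweepTape d P ((List.ofFn fun i => some (b i)) ++ R)) =
      (.inr (.pass d q a (carryBlock (M.sweepMask e d a) κ b) 0), j,
        sweepTape d ((List.ofFn fun i => some (mixBlock (M.sweepMask e d a) κ b i)).reverse ++ P)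
          R) := by
  have hK : K < K + 1 := by omega
  rw [Function.iterate_succ_apply', sweep_pass_iterate e w j q a κ P R _ (by simp) hK]
  rw [ofFn_drop_last, List.singleton_append, sweep_pass_step e w j q a _ _ _ _ _ (by simp)]
  refine Prod.ext ?_ (Prod.ext rfl ?_)
  · rw [if_pos (by rfl)]
    dsimp only
    simp only [reduceCtorEq, if_false]
    congr 2
    funext i
    by_cases hi : i = Fin.last K
    · subst hi
      by_cases hm : M.sweepMask e d a (Fin.last K) <;> simp [carryBlock, Fin.last]
    · have h1 : i.val < K := lt_of_le_of_ne (by omega) (fun h => hi (Fin.ext h))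
      have h2 : i ≠ ⟨K, hK⟩ := hi
      by_cases hm : M.sweepMask e d a i <;> simp [hm, h1, h2, carryBlock]
  · dsimp only
    conv_rhs => rw [ofFn_eq_take_append_last]
    simp [mixBlock, Fin.last]

/-- The blanks past the last block act as a zero block receiving the delayed bits. The machine turns
only after the last track, so the cells in use always form whole blocks. -/
theorem sweep_extend (q : M.Q) (a : M.Actions) (κ : Block K) (P : List (Option Bool)) :
    (dataStep w (M.sweepTrans e))^[K + 1]
      (.inr (.pass true q a κ 0), j, sweepTape true P []) =
      (.inr (.turn q a), j,
        sweepTape true ((List.ofFn fun i => some (mixBlock (M.sweepMask e true a) κ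
          (fun _ => false) i)).reverse ++ P) []) := by
  have hK : K < K + 1 := by omega
  have h0 : sweepTape true P ([] : List (Option Bool)) =
      sweepTape true P ((List.ofFn fun _ : Fin (K + 1) => (none : Option Bool)) ++ []) := by
    rw [List.append_nil, List.ofFn_const]
    exact (sweepTape_true_replicate P (K + 1)).symm
  rw [h0, Function.iterate_succ_apply', sweep_pass_iterate e w j q a κ P [] _ (by simp) hK]
  rw [ofFn_drop_last, List.singleton_append, sweep_pass_step e w j q a _ _ _ _ _ (by simp)]
  refine Prod.ext ?_ (Prod.ext rfl ?_)
  · rw [if_pos (by rfl)]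
    simp
  · dsimp only
    conv_rhs => rw [ofFn_eq_take_append_last]
    simp [mixBlock, Fin.last]

theorem sweep_blocks {d : Bool} (q : M.Q) (a : M.Actions) (κ : Block K) (l : List (Block K))
    (P R : List (Option Bool)) :
    (dataStep w (M.sweepTrans e))^[l.length * (K + 1)]
      (.inr (.pass d q a κ 0), j, sweepTape d P (blockCells l ++ R)) =
      (.inr (.pass d q a (delayBlocks (M.sweepMask e d a) κ l).2 0), j,
        sweepTape d ((blockCells (delayBlocks (M.sweepMask e d a) κ l).1).reverse ++ P) R) := by
  induction l generalizing κ P with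
  | nil => simp [delayBlocks, blockCells]
  | cons b l ih =>
    have hl : (b :: l).length * (K + 1) = l.length * (K + 1) + (K + 1) := by simp; ring
    have hcells : blockCells (b :: l) ++ R =
        (List.ofFn fun i => some (b i)) ++ (blockCells l ++ R) := by simp [blockCells]
    rw [hl, hcells]
    refine (iterate_trans (sweep_block e w j q a κ b P (blockCells l ++ R)) (ih _ _)).trans ?_
    simp [delayBlocks, blockCells]

end Sweep

end MultitapeTM

namespace MultitapeTM

/-! ### Correctness and cost of the simulation by sweeps -/

section Simulation

variable (M : MultitapeTM) {K : ℕ} (e : M.Track ≃ Fin (K + 1)) (w : List Bool)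

/-- The stacks `st` are stored in the blocks `l`. -/
def StoresStacks (l : List (Block K)) (st : Fin (M.k + 1) → Bool → List (TapeSym M.A)) : Prop :=
  ∀ i side p g, blockBit l p (e (i, side, g)) = true ↔ (st i side)[p]? = some g

/-- The unread part of the input, on the tape `i`. -/
def unreadInput (j : ℕ) (i : Fin (M.k + 1)) : List (TapeSym M.A) :=
  if i = 0 then (w.drop j).map .bit else []

/-- The sweeping machine is about to leave its home position, having stored the configuration `c`
of `M` in `n` blocks and a buffer. -/
def AtHome (c : ViewConfig M.Q (Fin (M.k + 1)) M.A) (X : DataConfig (M.SweepState K)) (n : ℕ) :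
    Prop :=
  ∃ (q : M.Q) (a : M.Actions) (κ : Block K) (l : List (Block K)) (j : ℕ)
    (st : Fin (M.k + 1) → Bool → List (TapeSym M.A)),
    X = (.inr (.pass false q a κ 0), j, sweepTape false (blockCells l) []) ∧ l.length = n ∧
    c.1 = .work q ∧ M.StoresStacks e l st ∧
    ∀ i, c.2 i = splitTape (st i false) (M.scannedSym e a κ w[j]? i ::
      (st i true ++ M.unreadInput w (if M.readsInput e a κ then j + 1 else j) i))

variable {M} {w}

/-- The stacks after a step. -/
def stepStacks (a : M.Actions) (st : Fin (M.k + 1) → Bool → List (TapeSym M.A))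
    (i : Fin (M.k + 1)) (side : Bool) : List (TapeSym M.A) :=
  if pushes (a i).2 side then (a i).1 :: st i side
  else if pops (a i).2 side then (st i side).tail else st i side

/-- The blocks after the sweep to the right. -/
noncomputable def pushedBlocks (a : M.Actions) (l : List (Block K)) : List (Block K) :=
  (delayBlocks (M.sweepMask e true a) (M.pushBuffer e a) (l ++ [fun _ => false])).1

/-- The blocks and the buffer after the sweep back, which reads the blocks backwards. -/
noncomputable def poppedBlocks (a : M.Actions) (l : List (Block K)) : List (Block K) × Block K :=
  delayBlocks (M.sweepMask e false a) (fun _ => false) (mirrorBlocks (pushedBlocks e a l))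

/-- The sweep starts with the one-hot code of the written symbols in its buffer, and only the tracks
of a stack that has to grow are delayed. -/
theorem blockBit_pushedBlocks {l : List (Block K)}
    {st : Fin (M.k + 1) → Bool → List (TapeSym M.A)} (h : M.StoresStacks e l st) (a : M.Actions)
    (i : Fin (M.k + 1)) (side : Bool) (p : ℕ) (g : TapeSym M.A) :
    blockBit (pushedBlocks e a l) p (e (i, side, g)) = true ↔
      (if pushes (a i).2 side then (a i).1 :: st i side else st i side)[p]? = some g := by
  rw [pushedBlocks, blockBit_delayBlocks]
  have hm : M.sweepMask e true a (e (i, side, g)) = pushes (a i).2 side := by simp [sweepMask]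
  rw [hm]
  by_cases hp : pushes (a i).2 side
  · rw [if_pos hp, if_pos hp]
    rcases p with _ | p
    · simp [pushBuffer]
    · simpa using h i side p g
  · rw [if_neg hp, if_neg hp]
    exact h i side p g

theorem not_pushes_of_pops {m : HeadMove} {side : Bool} (h : pops m side = true) :
    pushes m side = false := by
  cases m <;> cases side <;> simp_all [pops, pushes]

/-- A head move pushes on one side and pops on the other, never both on one stack. Hence the pushes
of the right sweep and the pops of the left sweep do not interfere. -/
theorem storesStacks_poppedBlocks {l : List (Block K)}
    {st : Fin (M.k + 1) → Bool → List (TapeSym M.A)} (h : M.StoresStacks e l st) (a : M.Actions) :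
    M.StoresStacks e (mirrorBlocks (poppedBlocks e a l).1) (stepStacks a st) := by
  intro i side p g
  rw [poppedBlocks, (blockBit_delayBlocks_mirror _ _ _).1]
  have hm : M.sweepMask e false a (e (i, side, g)).rev = pops (a i).2 side := by simp [sweepMask]
  rw [hm]
  by_cases hp : pops (a i).2 side
  · rw [if_pos hp, blockBit_pushedBlocks e h]
    simp [stepStacks, not_pushes_of_pops hp, hp]
  · rw [if_neg hp, blockBit_pushedBlocks e h]
    simp [stepStacks, hp]

/-- An empty stack leaves no marked track in the buffer and decodes to `none`. This separates it
from a stack whose top is a stored blank, and so detects when a fresh input letter is needed. -/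
theorem poppedSym_poppedBlocks {l : List (Block K)}
    {st : Fin (M.k + 1) → Bool → List (TapeSym M.A)} (h : M.StoresStacks e l st) (a : M.Actions)
    {i : Fin (M.k + 1)} {side : Bool} (hp : pops (a i).2 side = true) :
    M.poppedSym e (poppedBlocks e a l).2 i side = (st i side).head? := by
  refine decodeTrack_eq fun g => ?_
  rw [poppedBlocks, (blockBit_delayBlocks_mirror _ _ _).2]
  have hm : M.sweepMask e false a (e (i, side, g)).rev = pops (a i).2 side := by simp [sweepMask]
  rw [hm, hp, Bool.true_and, blockBit_pushedBlocks e h, not_pushes_of_pops hp, List.head?_eq_getElem?]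
  simp

/-- The unread input serves as the bottom of the right stack of tape `0`. Past the end of the word
`w[j]?` is `none` and is read as a blank, so the one-way input head may go on moving. -/
theorem splitTape_unreadInput (L : List (TapeSym M.A)) (j : ℕ) (i : Fin (M.k + 1)) :
    splitTape L (M.unreadInput w j i) = splitTape L
      ((if i = 0 then .ofOption w[j]? else .blank) :: M.unreadInput w (j + 1) i) := by
  unfold unreadInput
  split_ifs with hi
  · by_cases hj : j < w.length
    · rw [List.drop_eq_getElem_cons hj, List.map_cons, List.getElem?_eq_getElem hj]
      rfl
    · rw [List.drop_of_length_le (by omega), List.drop_of_length_le (by omega),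
        List.getElem?_eq_none (by omega)]
      exact (splitTape_right_default L).symm
  · exact (splitTape_right_default L).symm

/-- The tapes of `M` after a step, in terms of the stacks, the buffer and the next input letter. -/
theorem act_eq_splitTape {l : List (Block K)}
    {st : Fin (M.k + 1) → Bool → List (TapeSym M.A)} (h : M.StoresStacks e l st) (a : M.Actions)
    (s : TapeSym M.A) (j : ℕ) (i : Fin (M.k + 1)) :
    act (splitTape (st i false) (s :: (st i true ++ M.unreadInput w j i))) (a i).1 (a i).2 =
      splitTape (stepStacks a st i false) (M.scannedSym e a (poppedBlocks e a l).2 w[j]? i ::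
        (stepStacks a st i true ++ M.unreadInput w
          (if M.readsInput e a (poppedBlocks e a l).2 then j + 1 else j) i)) := by
  have hreads : (a i).2 ≠ .right → M.unreadInput w
      (if M.readsInput e a (poppedBlocks e a l).2 then j + 1 else j) i = M.unreadInput w j i := by
    intro hi
    by_cases h0 : i = 0
    · subst h0
      have : M.readsInput e a (poppedBlocks e a l).2 = false := by
        unfold readsInput
        split
        · contradiction
        · rfl
      rw [this]; rfl
    · simp [unreadInput, h0]
  rcases hmv : (a i).2 with _ | _ | _
  · rw [hreads (by simp [hmv]), act_splitTape_left]
    have hpop := poppedSym_poppedBlocks e h a (i := i) (side := false) (by rw [hmv]; rfl)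
    simp only [scannedSym, hmv, hpop, stepStacks, pushes, pops]
    simp only [Bool.not_false, Bool.not_true, if_true, Bool.false_eq_true, if_false, List.tail_cons,
      List.cons_append, List.headD_eq_head?_getD]
    rfl
  · rw [hreads (by simp [hmv]), act_splitTape_stay]
    simp [scannedSym, hmv, stepStacks, pushes, pops]
  · rw [act_splitTape_right]
    have hpop := poppedSym_poppedBlocks e h a (i := i) (side := true) (by rw [hmv]; rfl)
    simp only [scannedSym, hmv, hpop, stepStacks, pushes, pops]
    simp only [Bool.not_false, Bool.not_true, if_true, Bool.false_eq_true, if_false, List.tail_cons]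
    rcases hst : st i true with _ | ⟨g, st'⟩
    · have hr : M.unreadInput w
          (if M.readsInput e a (poppedBlocks e a l).2 then j + 1 else j) i =
          M.unreadInput w (j + 1) i := by
        by_cases h0 : i = 0
        · subst h0
          have : M.readsInput e a (poppedBlocks e a l).2 = true := by
            simp [readsInput, hmv, hpop, hst]
          rw [this]; rfl
        · simp [unreadInput, h0]
      rw [hr]
      simpa using splitTape_unreadInput ((a i).1 :: st i false) j i
    · have hr : M.unreadInput w
          (if M.readsInput e a (poppedBlocks e a l).2 then j + 1 else j) i =
          M.unreadInput w j i := by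
        by_cases h0 : i = 0
        · subst h0
          have : M.readsInput e a (poppedBlocks e a l).2 = false := by
            simp [readsInput, hmv, hpop, hst]
          rw [this]; rfl
        · simp [unreadInput, h0]
      rw [hr]
      simp

/-- The start is presented as the outcome of a fictitious step: with all stacks empty, the input
head has just moved right onto the first letter and the other heads have stayed on a blank. The
general rule for scanned symbols then needs no exception. -/
theorem atHome_init : M.AtHome e w (M.init w).view
    (.inr (.pass false M.start (fun i => (.blank, if i = 0 then .right else .stay))
      (fun _ => false) 0), 0, fun _ => none) 0 := by
  refine ⟨M.start, fun i => (.blank, if i = 0 then .right else .stay), fun _ => false, [], 0,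
    fun _ _ => [], ?_, rfl, rfl, ?_, ?_⟩
  · refine Prod.ext rfl (Prod.ext rfl (funext fun z => ?_))
    rcases z with (_ | n) | n <;> rfl
  · intro i side p g
    simp [blockBit]
  · intro i
    have hpop : ∀ (i : Fin (M.k + 1)) side, M.poppedSym e (fun _ => false) i side = none := by
      intro i side
      exact decodeTrack_eq fun g => by simp
    rw [view_init]
    by_cases hi : i = 0
    · subst hi
      have := splitTape_unreadInput (M := M) (w := w) [] 0 0
      simp only [unreadInput, if_true, List.drop_zero] at this
      simp only [if_true]
      rw [wordTape_eq_splitTape, this]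
      simp [scannedSym, readsInput, hpop, unreadInput]
    · simp only [hi, if_false, scannedSym, unreadInput]
      rw [wordTape_eq_splitTape]
      exact (splitTape_right_default []).symm

/-- The transition of `M` is evaluated on leaving home, so a final answer appears, inverted, after
one step. Otherwise the exponent lists, from right to left: departure, pushing sweep over `n`
blocks, creation of a block, turn, popping sweep over `n + 1` blocks. -/
theorem atHome_step {c : ViewConfig M.Q (Fin (M.k + 1)) M.A} {X : DataConfig (M.SweepState K)}
    {n : ℕ} (h : M.AtHome e w c X n) :
    ((viewStep M.δ c).1 = .yes → (dataStep w (M.sweepTrans e) X).1 = .inl false) ∧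
    ((viewStep M.δ c).1 = .no → (dataStep w (M.sweepTrans e) X).1 = .inl true) ∧
    ((viewStep M.δ c).1.IsWork → M.AtHome e w (viewStep M.δ c)
      ((dataStep w (M.sweepTrans e))^[(n + 1) * (K + 1) + (1 + ((K + 1) + (n * (K + 1) + 1)))] X)
        (n + 1)) := by
  obtain ⟨q, a, κ, l, j, st, rfl, hl, hq, hst, htape⟩ := h
  have hheads : (fun i => c.2 i 0) = M.scannedSym e a κ w[j]? := by
    funext i; rw [htape i]; simp
  have hc : c = (.work q, c.2) := Prod.ext hq rfl
  have hstep := viewStep_work M.δ q c.2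
  rw [← hc, hheads] at hstep
  rw [hstep]
  refine ⟨fun hy => ?_, fun hn => ?_, fun hw => ?_⟩
  · rcases hδ : M.δ q (M.scannedSym e a κ w[j]?) with ⟨r, a'⟩
    rw [hδ] at hy
    obtain rfl : r = .yes := hy
    simp [dataStep, sweepTrans, hδ, Option.default_eq_none]
  · rcases hδ : M.δ q (M.scannedSym e a κ w[j]?) with ⟨r, a'⟩
    rw [hδ] at hn
    obtain rfl : r = .no := hn
    simp [dataStep, sweepTrans, hδ, Option.default_eq_none]
  · rcases hδ : M.δ q (M.scannedSym e a κ w[j]?) with ⟨r, a'⟩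
    rw [hδ] at hw
    obtain ⟨q', rfl⟩ : ∃ q', r = .work q' := hw
    set j' := if M.readsInput e a κ then j + 1 else j with hj'
    have h1 : (dataStep w (M.sweepTrans e))^[1]
        (.inr (.pass false q a κ 0), j, sweepTape false (blockCells l) []) =
        (.inr (.pass true q' a' (M.pushBuffer e a') 0), j',
          sweepTape true [] (blockCells l ++ [])) := by
      rw [Function.iterate_one, dataStep_inr (q' := .pass true q' a' (M.pushBuffer e a') 0)
        (a := none) (m := .right) (adv := M.readsInput e a κ)]
      · have := act_sweepTape_turn false (blockCells l)
        rw [List.append_nil]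
        refine Prod.ext rfl (Prod.ext rfl this)
      · simp [sweepTrans, hδ, Option.default_eq_none]
    have h2 := sweep_blocks e w j' q' a' (M.pushBuffer e a') (d := true) l [] []
    have h3 := sweep_extend e w j' q' a'
      (delayBlocks (M.sweepMask e true a') (M.pushBuffer e a') l).2
      ((blockCells (delayBlocks (M.sweepMask e true a') (M.pushBuffer e a') l).1).reverse ++ [])
    have hcells : (List.ofFn fun i => some (mixBlock (M.sweepMask e true a')
        (delayBlocks (M.sweepMask e true a') (M.pushBuffer e a') l).2
          (fun _ => false) i)).reverse ++
        ((blockCells (delayBlocks (M.sweepMask e true a') (M.pushBuffer e a') l).1).reverse ++ [])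
        = blockCells (mirrorBlocks (pushedBlocks e a' l)) := by
      rw [← blockCells_reverse, pushedBlocks, delayBlocks_append_singleton, List.append_nil,
        ← List.reverse_append]
      simp [blockCells]
    rw [hcells] at h3
    have h4 : (dataStep w (M.sweepTrans e))^[1]
        (.inr (.turn q' a'), j',
          sweepTape true (blockCells (mirrorBlocks (pushedBlocks e a' l))) []) =
        (.inr (.pass false q' a' (fun _ => false) 0), j',
          sweepTape false [] (blockCells (mirrorBlocks (pushedBlocks e a' l)) ++ [])) := by
      rw [Function.iterate_one, dataStep_inr (q' := .pass false q' a' (fun _ => false) 0)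
        (a := none) (m := .left) (adv := false)]
      · have := act_sweepTape_turn true (blockCells (mirrorBlocks (pushedBlocks e a' l)))
        rw [List.append_nil]
        refine Prod.ext rfl (Prod.ext rfl this)
      · simp [sweepTrans]
    have h5 := sweep_blocks e w j' q' a' (fun _ => false) (d := false)
      (mirrorBlocks (pushedBlocks e a' l)) [] []
    have hlen : (mirrorBlocks (pushedBlocks e a' l)).length = n + 1 := by
      simp [mirrorBlocks, pushedBlocks, delayBlocks_length, hl]
    rw [hlen] at h5
    rw [hl] at h2
    rw [iterate_trans (iterate_trans (iterate_trans (iterate_trans h1 h2) h3) h4) h5]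
    refine ⟨q', a', (poppedBlocks e a' l).2, mirrorBlocks (poppedBlocks e a' l).1, j',
      stepStacks a' st, ?_, ?_, rfl, storesStacks_poppedBlocks e hst a', fun i => ?_⟩
    · rw [← blockCells_reverse, List.append_nil]
      rfl
    · simp [mirrorBlocks, poppedBlocks, delayBlocks_length, pushedBlocks, hl]
    · change act (c.2 i) (a' i).1 (a' i).2 = _
      rw [htape i]
      exact act_eq_splitTape e hst a' _ _ _

theorem atHome_iterate (t : ℕ) (h : ((viewStep M.δ)^[t] (M.init w).view).1.IsWork) :
    ∃ s ≤ (2 * K + 4) * t ^ 2, M.AtHome e w ((viewStep M.δ)^[t] (M.init w).view)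
      ((dataStep w (M.sweepTrans e))^[s]
        (.inr (.pass false M.start (fun i => (.blank, if i = 0 then .right else .stay))
          (fun _ => false) 0), 0, fun _ => none)) t := by
  induction t with
  | zero => exact ⟨0, by simp, atHome_init e⟩
  | succ t ih =>
    obtain ⟨s, hs, hh⟩ := ih (isWork_of_le _ h (Nat.le_succ t))
    rw [Function.iterate_succ_apply'] at h ⊢
    refine ⟨(t + 1) * (K + 1) + (1 + ((K + 1) + (t * (K + 1) + 1))) + s, ?_, ?_⟩
    -- The round costs `(2 * t + 2) * (K + 1) + 2` steps, which is at most `(2 * K + 4) * ((t + 1) ^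
    -- 2 - t ^ 2)`.
    · nlinarith
    · rw [Function.iterate_add_apply]
      exact (atHome_step e hh).2.2 h

end Simulation

/-- Every machine `M` has a program with which the interpreter answers the opposite of `M`, in
time quadratic in that of `M`. -/
theorem exists_program (M : MultitapeTM) :
    ∃ (u : List Bool) (Z : ℕ), ∀ (A : Type) (v : List Bool) (t : ℕ) (b : Bool),
      (M.run (u ++ v) t).state = .answer b →
        ∃ t' ≤ Z * (t + 1) ^ 2, ((viewStep interpTrans)^[t'] (interpConfig (u ++ v) .rewind 0 0
          (addressTape 0 : ℤ → TapeSym A) fun _ => none)).1 = .answer !b := by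
  obtain ⟨K, e, -⟩ := exists_equiv_fin_map_zero ((0, true, .blank) : M.Track)
  obtain ⟨tab, Z, hZ⟩ := exists_table (M.sweepTrans e)
    (.pass false M.start (fun i => (.blank, if i = 0 then .right else .stay)) (fun _ => false) 0)
  refine ⟨encodeTable tab, Z * (2 * K + 5), fun A v t b h => ?_⟩
  set w := encodeTable tab ++ v with hw
  rw [run_state] at h
  have hnw : ¬ ((viewStep M.δ)^[t] (M.init w).view).1.IsWork := by
    rw [h]; exact Ctrl.not_isWork_answer b
  -- The time `t` only bounds the halting time. The simulation is followed up to the last working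
  -- configuration, from which one more step gives the answer.
  obtain ⟨t₁, ht₁, hwk, hlast⟩ := exists_last_isWork M.δ ⟨M.start, rfl⟩ hnw
  have hans := h
  rw [viewStep_iterate_eq_of_le _ hlast (by omega : t₁ + 1 ≤ t)] at hans
  obtain ⟨s, hs, hh⟩ := atHome_iterate e t₁ hwk
  rw [Function.iterate_succ_apply'] at hans
  have hstep := atHome_step e hh
  have hd : ((dataStep w (M.sweepTrans e))^[s + 1]
        (.inr (.pass false M.start (fun i => (.blank, if i = 0 then .right else .stay))
          (fun _ => false) 0), 0, fun _ => none)).1 = .inl !b := by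
    rw [Function.iterate_succ_apply']
    cases b
    · exact hstep.2.1 hans
    · exact hstep.1 hans
  obtain ⟨t', ht', hf⟩ := hZ A w v hw (s + 1) (!b) hd
  refine ⟨t', ht'.trans ?_, hf⟩
  rw [mul_assoc]
  refine Nat.mul_le_mul_left Z ?_
  have : t₁ ^ 2 ≤ (t + 1) ^ 2 := Nat.pow_le_pow_left (by omega) 2
  have h1 : 1 ≤ (t + 1) ^ 2 := Nat.one_le_pow _ _ (by omega)
  nlinarith

end MultitapeTM

/-! ### The clock -/

namespace MultitapeTM

theorem run_succ (M : MultitapeTM) (w : List Bool) (t : ℕ) :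
    M.run w (t + 1) = M.step (M.run w t) := by
  simp only [run, Function.iterate_succ_apply']

theorem step_of_not_isWork (M : MultitapeTM) {c : M.Config} (h : ¬ c.state.IsWork) :
    M.step c = c := by
  rcases c with ⟨_ | _ | _ | _, T, p⟩
  · exact absurd ⟨_, rfl⟩ h
  all_goals rfl

theorem run_eq_of_le (M : MultitapeTM) {w : List Bool} {s t : ℕ}
    (h : ¬ (M.run w s).state.IsWork) (hst : s ≤ t) : M.run w t = M.run w s := by
  obtain ⟨u, rfl⟩ := Nat.exists_eq_add_of_le hst
  induction u with
  | zero => rfl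
  | succ u ih => rw [← add_assoc, run_succ, ih (by omega), step_of_not_isWork M h]

theorem exists_last_work (M : MultitapeTM) {w : List Bool} {t : ℕ}
    (h : ¬ (M.run w t).state.IsWork) :
    ∃ s < t, (M.run w s).state.IsWork ∧ ¬ (M.run w (s + 1)).state.IsWork := by
  simp only [run_state] at h ⊢
  exact exists_last_isWork M.δ ⟨M.start, rfl⟩ h

/-- After `t` steps no head is beyond cell `t`, and the non-input tapes are blank from there on. -/
theorem run_blank_of_le (M : MultitapeTM) (w : List Bool) (t : ℕ) (i : Fin (M.k + 1)) :
    (M.run w t).head i ≤ t ∧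
      (i ≠ 0 → ∀ z : ℤ, (t : ℤ) ≤ z → (M.run w t).tape i z = .blank) := by
  induction t with
  | zero =>
    refine ⟨le_of_eq rfl, fun hi z _ => ?_⟩
    simp only [run, Function.iterate_zero, id, init, if_neg hi]
    exact wordTape_nil z
  | succ t ih =>
    rw [run_succ]
    generalize M.run w t = c at ih
    rcases c with ⟨q | _ | _ | _, T, p⟩
    · obtain ⟨h1, h2⟩ := ih
      simp only at h1 h2
      constructor
      · simp only [step]
        rcases ((M.δ q fun i => T i (p i)).2 i).2 <;> simp [HeadMove.toInt] <;> omega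
      · intro hi z hz
        simp only [step, Function.update_apply]
        push_cast at hz
        rw [if_neg (by omega)]
        exact h2 hi z (by omega)
    all_goals
      simp only [step]
      refine ⟨ih.1.trans (by push_cast; omega), fun hi z hz => ih.2 hi z (by push_cast at hz; omega)⟩

theorem run_tape_zero_of_readOnlyInput (M : MultitapeTM) (h : M.ReadOnlyInput) (w : List Bool)
    (t : ℕ) : (M.run w t).tape 0 = wordTape w := by
  induction t with
  | zero => rfl
  | succ t ih =>
    rw [run_succ]
    generalize M.run w t = c at ih
    rcases c with ⟨q | _ | _ | _, T, p⟩
    · simp only [step, h.1]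
      rw [Function.update_eq_self]
      exact ih
    all_goals exact ih

end MultitapeTM

/-- A machine whose running time on `w` is at least `f |w|` and linear in `|w| + f |w|`. -/
theorem IsProperComplexity.exists_timer {f : ℕ → ℕ} (hf : IsProperComplexity f) :
    ∃ (M : MultitapeTM) (c : ℕ), ∀ w : List Bool, ∃ t, (M.run w t).state.IsWork ∧
      ¬ (M.run w (t + 1)).state.IsWork ∧ f w.length ≤ t + 1 ∧
        t + 1 ≤ c * (w.length + f w.length) + c := by
  obtain ⟨-, M, c, hro, hM⟩ := hf
  have hk : Fin.last M.k ≠ 0 := by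
    intro hk
    -- A read-only tape with the letter `0` cannot show a word of ones, so the output tape differs
    -- from the input tape.
    obtain ⟨t, -, ⟨-, hout⟩, -⟩ := hM [false]
    rw [hk, M.run_tape_zero_of_readOnlyInput hro] at hout
    have h0 := congrFun hout ((0 : ℕ) : ℤ)
    simp only [MultitapeTM.wordTape_natCast] at h0
    rcases hn : f [false].length with _ | n
    · rw [hn] at h0; simp at h0
    · rw [hn] at h0; simp [List.replicate_succ] at h0
  refine ⟨M, c, fun w => ?_⟩
  obtain ⟨T, hT, ⟨hhalt, hout⟩, -⟩ := hM w
  have hnw : ¬ (M.run w T).state.IsWork := by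
    rintro ⟨q, hq⟩; rw [hhalt] at hq; simp at hq
  obtain ⟨t, htT, hw, hn⟩ := M.exists_last_work hnw
  refine ⟨t, hw, hn, ?_, by omega⟩
  rw [M.run_eq_of_le hn (by omega : t + 1 ≤ T)] at hout
  by_contra hlt
  -- If `f |w|` exceeded `t + 1`, the output would have a mark in cell `t + 1`, which cannot be
  -- written within `t + 1` steps.
  have h1 := (M.run_blank_of_le w (t + 1) (Fin.last M.k)).2 hk ((t + 1 : ℕ) : ℤ) le_rfl
  rw [hout, MultitapeTM.wordTape_natCast, List.getElem?_replicate, if_pos (by omega)] at h1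
  simp at h1

/-- The states of the clock: counting the steps of `M`, or running down the odometer. -/
inductive ClockState (M : MultitapeTM) (d : ℕ) : Type
  | count (q : M.Q) (r : Fin (d + 1))
  | odometer (d₁ d₂ : Bool)

instance (M : MultitapeTM) (d : ℕ) : Finite (ClockState M d) :=
  Finite.of_surjective (fun x : (M.Q × Fin (d + 1)) ⊕ (Bool × Bool) => match x with
    | .inl (q, r) => ClockState.count q r
    | .inr (a, b) => .odometer a b) (by
    rintro (⟨q, r⟩ | ⟨a, b⟩)
    exacts [⟨.inl (q, r), rfl⟩, ⟨.inr (a, b), rfl⟩])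

/-- The tapes of the clock: those of `M` and three counters. -/
abbrev ClockTape (M : MultitapeTM) : Type := Fin (M.k + 1) ⊕ Fin 3

section Clock

variable (M : MultitapeTM) (d : ℕ)

/-- The clock writes one mark on each counter for every `d + 1` steps of `M`. When `M` halts, the
counter heads bounce between the ends of their marks; a head moves whenever the previous one is at
an end. -/
def clockTrans : TransFun (ClockState M d) (ClockTape M) M.A
  | .count q r, σ =>
    match M.δ q (σ ∘ Sum.inl) with
    | (.work q', a) => (.work (.count q' (r + 1)), Sum.elim a fun i =>
        if r = Fin.last d then (.bit true, .right) else (σ (.inr i), .stay))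
    | (_, a) => (.work (.odometer false false), Sum.elim a fun i => (σ (.inr i), .left))
  | .odometer d₁ d₂, σ =>
    let out (s : Ctrl (ClockState M d)) (m₁ m₂ m₃ : HeadMove) :
        Ctrl (ClockState M d) × (ClockTape M → TapeSym M.A × HeadMove) :=
      (s, Sum.elim (fun i => (σ (.inl i), .stay))
        ![(σ (.inr 0), m₁), (σ (.inr 1), m₂), (σ (.inr 2), m₃)])
    if (σ (.inr 0)).toOption ≠ none then out (.work (.odometer d₁ d₂)) (sweepMove d₁) .stay .stay
    else if (σ (.inr 1)).toOption ≠ none then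
      out (.work (.odometer (!d₁) d₂)) (sweepMove !d₁) (sweepMove d₂) .stay
    else if (σ (.inr 2)).toOption ≠ none then
      out (.work (.odometer (!d₁) (!d₂))) (sweepMove !d₁) (sweepMove !d₂) .left
    else out .halt .stay .stay .stay

variable {M} {d}

/-- A counter with `s` marks and its head at `x`. -/
def counterTape {A : Type} (s : ℕ) (x : ℤ) : ℤ → TapeSym A :=
  shiftTape (MultitapeTM.wordTape (List.replicate s true)) x

theorem counterTape_ne_none {A : Type} (s : ℕ) (x : ℤ) :
    (counterTape s x 0 : TapeSym A).toOption ≠ none ↔ 0 ≤ x ∧ x < s := by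
  rw [counterTape, shiftTape_apply_zero]
  rcases lt_or_ge x 0 with hx | hx
  · rw [MultitapeTM.wordTape_of_neg _ hx]
    simp [TapeSym.toOption, hx]
  · obtain ⟨n, rfl⟩ := Int.eq_ofNat_of_zero_le hx
    rw [MultitapeTM.toOption_wordTape, List.getElem?_replicate]
    simp

theorem act_counterTape {A : Type} (s : ℕ) (x : ℤ) (m : HeadMove) :
    act (counterTape s x) (counterTape s x 0) m =
      (counterTape s (x + m.toInt) : ℤ → TapeSym A) := by
  rw [counterTape, shiftTape_apply_zero, act_shiftTape]
  rfl

theorem act_counterTape_mark {A : Type} (s : ℕ) :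
    act (counterTape s s) (.bit true) .right =
      (counterTape (s + 1) ((s + 1 : ℕ) : ℤ) : ℤ → TapeSym A) := by
  have := MultitapeTM.act_shiftTape_wordTape (A := A) (List.replicate s true) true
  rw [List.length_replicate, ← List.replicate_succ'] at this
  rw [counterTape, this]
  push_cast
  rfl

/-- The position of a bouncing head that reaches the end of its `s` marks after `r` moves. -/
def bouncePos (s : ℕ) (right : Bool) (r : ℕ) : ℤ := if right then (s : ℤ) - r else (r : ℤ) - 1

theorem counterTape_bouncePos_ne_none {A : Type} {s r : ℕ} (hr : r ≤ s) (b : Bool) :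
    (counterTape s (bouncePos s b r) 0 : TapeSym A).toOption ≠ none ↔ r ≠ 0 := by
  rw [counterTape_ne_none, bouncePos]
  cases b <;> simp <;> omega

theorem bouncePos_move (s : ℕ) (b : Bool) (r : ℕ) :
    bouncePos s b (r + 1) + (sweepMove b).toInt = bouncePos s b r := by
  cases b <;> simp [bouncePos, sweepMove, HeadMove.toInt] <;> ring

/-- A head at its end stands on the blank beyond the marks; the single move back leaves exactly `s`
moves to the other end. -/
theorem bouncePos_turn (s : ℕ) (b : Bool) :
    bouncePos s b 0 + (sweepMove !b).toInt = bouncePos s (!b) s := by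
  cases b <;> simp [bouncePos, sweepMove, HeadMove.toInt]; ring

/-- A configuration of the odometer: `r₁`, `r₂`, `r₃` moves are left to the three heads. -/
def odometerConfig (T : Fin (M.k + 1) → ℤ → TapeSym M.A) (s : ℕ) (d₁ d₂ : Bool) (r₁ r₂ r₃ : ℕ) :
    ViewConfig (ClockState M d) (ClockTape M) M.A :=
  (.work (.odometer d₁ d₂), Sum.elim T ![counterTape s (bouncePos s d₁ r₁),
    counterTape s (bouncePos s d₂ r₂), counterTape s (bouncePos s false r₃)])

theorem viewStep_odometer {T : Fin (M.k + 1) → ℤ → TapeSym M.A} {C₁ C₂ C₃ : ℤ → TapeSym M.A}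
    {d₁ d₂ : Bool} {s : Ctrl (ClockState M d)} {m₁ m₂ m₃ : HeadMove}
    (h : clockTrans M d (.odometer d₁ d₂)
        (fun i => (Sum.elim T ![C₁, C₂, C₃] : ClockTape M → ℤ → TapeSym M.A) i 0) =
      (s, Sum.elim (fun i => (T i 0, .stay)) ![(C₁ 0, m₁), (C₂ 0, m₂), (C₃ 0, m₃)])) :
    viewStep (clockTrans M d) (.work (.odometer d₁ d₂), Sum.elim T ![C₁, C₂, C₃]) =
      (s, Sum.elim T ![act C₁ (C₁ 0) m₁, act C₂ (C₂ 0) m₂, act C₃ (C₃ 0) m₃]) := by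
  rw [viewStep_work, h]
  refine Prod.ext rfl (funext fun i => ?_)
  rcases i with i | i
  · exact act_stay_self (T i)
  · fin_cases i <;> rfl

/-! ### The odometer as a countdown in base `s + 1` -/

section OdometerStep

variable (T : Fin (M.k + 1) → ℤ → TapeSym M.A) {s : ℕ} (d₁ d₂ : Bool)

theorem odometer_first {r₁ : ℕ} (r₂ r₃ : ℕ) (h₁ : r₁ + 1 ≤ s) :
    viewStep (clockTrans M d) (odometerConfig T s d₁ d₂ (r₁ + 1) r₂ r₃) =
      odometerConfig T s d₁ d₂ r₁ r₂ r₃ := by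
  have e₁ := (counterTape_bouncePos_ne_none (A := M.A) h₁ d₁).2 (by omega)
  rw [odometerConfig, viewStep_odometer (s := .work (.odometer d₁ d₂)) (m₁ := sweepMove d₁)
    (m₂ := .stay) (m₃ := .stay)]
  · simp only [act_counterTape, bouncePos_move]
    simp [odometerConfig, HeadMove.toInt]
  · exact (if_pos e₁).trans rfl

/-- This is a borrow: turning the first head resets its digit to `s` in the very step that lowers
the second digit, so the value drops by exactly one. -/
theorem odometer_second {r₂ : ℕ} (r₃ : ℕ) (h₂ : r₂ + 1 ≤ s) :
    viewStep (clockTrans M d) (odometerConfig T s d₁ d₂ 0 (r₂ + 1) r₃) =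
      odometerConfig T s (!d₁) d₂ s r₂ r₃ := by
  have e₁ := (counterTape_bouncePos_ne_none (A := M.A) (Nat.zero_le s) d₁).not.2 (by simp)
  have e₂ := (counterTape_bouncePos_ne_none (A := M.A) h₂ d₂).2 (by omega)
  rw [odometerConfig, viewStep_odometer (s := .work (.odometer (!d₁) d₂)) (m₁ := sweepMove !d₁)
    (m₂ := sweepMove d₂) (m₃ := .stay)]
  · simp only [act_counterTape, bouncePos_move, bouncePos_turn]
    simp [odometerConfig, HeadMove.toInt]
  · exact (if_neg e₁).trans ((if_pos e₂).trans rfl)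

theorem odometer_third {r₃ : ℕ} (h₃ : r₃ + 1 ≤ s) :
    viewStep (clockTrans M d) (odometerConfig T s d₁ d₂ 0 0 (r₃ + 1)) =
      odometerConfig T s (!d₁) (!d₂) s s r₃ := by
  have e₁ := (counterTape_bouncePos_ne_none (A := M.A) (Nat.zero_le s) d₁).not.2 (by simp)
  have e₂ := (counterTape_bouncePos_ne_none (A := M.A) (Nat.zero_le s) d₂).not.2 (by simp)
  have e₃ := (counterTape_bouncePos_ne_none (A := M.A) h₃ false).2 (by omega)
  have hm : bouncePos s false (r₃ + 1) + HeadMove.left.toInt = bouncePos s false r₃ :=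
    bouncePos_move s false r₃
  rw [odometerConfig, viewStep_odometer (s := .work (.odometer (!d₁) (!d₂)))
    (m₁ := sweepMove !d₁) (m₂ := sweepMove !d₂) (m₃ := .left)]
  · simp only [act_counterTape, bouncePos_turn, hm]
    rfl
  · exact (if_neg e₁).trans ((if_neg e₂).trans ((if_pos e₃).trans rfl))

theorem odometer_end :
    (viewStep (clockTrans M d) (odometerConfig T s d₁ d₂ 0 0 0)).1 = .halt := by
  have e₁ := (counterTape_bouncePos_ne_none (A := M.A) (Nat.zero_le s) d₁).not.2 (by simp)
  have e₂ := (counterTape_bouncePos_ne_none (A := M.A) (Nat.zero_le s) d₂).not.2 (by simp)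
  have e₃ := (counterTape_bouncePos_ne_none (A := M.A) (Nat.zero_le s) false).not.2 (by simp)
  rw [odometerConfig, viewStep_odometer (s := .halt) (m₁ := .stay) (m₂ := .stay) (m₃ := .stay)]
  exact (if_neg e₁).trans ((if_neg e₂).trans ((if_neg e₃).trans rfl))

/-- The odometer runs for exactly as many steps as its value in base `s + 1`. -/
theorem odometer_run (V : ℕ) (r₁ r₂ r₃ : ℕ) (h₁ : r₁ ≤ s) (h₂ : r₂ ≤ s) (h₃ : r₃ ≤ s)
    (hV : V = r₁ + (s + 1) * r₂ + (s + 1) ^ 2 * r₃) :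
    ((viewStep (clockTrans M d))^[V] (odometerConfig T s d₁ d₂ r₁ r₂ r₃)).1.IsWork ∧
      ((viewStep (clockTrans M d))^[V + 1] (odometerConfig T s d₁ d₂ r₁ r₂ r₃)).1 = .halt := by
  induction V generalizing d₁ d₂ r₁ r₂ r₃ with
  | zero =>
    have e₁ : r₁ = 0 := by omega
    have e₂ : r₂ = 0 := by
      by_contra h
      have := Nat.le_mul_of_pos_right (s + 1) (Nat.pos_of_ne_zero h)
      omega
    have e₃ : r₃ = 0 := by
      by_contra h
      have h1 := Nat.le_mul_of_pos_right ((s + 1) ^ 2) (Nat.pos_of_ne_zero h)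
      have h2 : 0 < (s + 1) ^ 2 := by positivity
      omega
    subst e₁ e₂ e₃
    exact ⟨⟨_, rfl⟩, odometer_end T d₁ d₂⟩
  | succ V ih =>
    rw [Function.iterate_succ_apply, Function.iterate_succ_apply]
    rcases r₁ with _ | r₁
    · rcases r₂ with _ | r₂
      · rcases r₃ with _ | r₃
        · simp at hV
        · rw [odometer_third T d₁ d₂ h₃]
          exact ih _ _ _ _ _ le_rfl le_rfl (by omega) (by nlinarith)
      · rw [odometer_second T d₁ d₂ r₃ h₂]
        exact ih _ _ _ _ _ le_rfl (by omega) h₃ (by nlinarith)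
    · rw [odometer_first T d₁ d₂ r₂ r₃ h₁]
      exact ih _ _ _ _ _ (by omega) h₂ h₃ (by omega)

end OdometerStep

/-- The initial configuration of the clock. -/
def clockInit (M : MultitapeTM) (d : ℕ) (w : List Bool) :
    ViewConfig (ClockState M d) (ClockTape M) M.A :=
  (.work (.count M.start 0), Sum.elim (M.init w).view.2 fun _ => MultitapeTM.wordTape [])

theorem clock_count (w : List Bool) (t : ℕ) (q : M.Q)
    (h : ((viewStep M.δ)^[t] (M.init w).view).1 = .work q) :
    ∃ (s : ℕ) (r : Fin (d + 1)), t = s * (d + 1) + r ∧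
      (viewStep (clockTrans M d))^[t] (clockInit M d w) =
        (.work (.count q r), Sum.elim ((viewStep M.δ)^[t] (M.init w).view).2
          fun _ => counterTape s s) := by
  induction t generalizing q with
  | zero =>
    refine ⟨0, 0, by simp, ?_⟩
    obtain rfl : M.start = q := by
      rw [Function.iterate_zero, id, MultitapeTM.view_init] at h
      simpa using h
    simp [clockInit, counterTape, shiftTape_zero]
  | succ t ih =>
    obtain ⟨q', hq'⟩ := isWork_of_le M.δ ⟨q, h⟩ (Nat.le_succ t)
    obtain ⟨s, r, ht, hc⟩ := ih q' hq'
    rw [Function.iterate_succ_apply', hc, Function.iterate_succ_apply']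
    rw [Function.iterate_succ_apply'] at h
    generalize (viewStep M.δ)^[t] (M.init w).view = c at hq' h
    rcases c with ⟨_, T⟩
    obtain rfl := hq'
    rw [viewStep_work] at h ⊢
    rw [viewStep_work]
    have hδ : M.δ q' (fun i => T i 0) = (.work q, (M.δ q' fun i => T i 0).2) := Prod.ext h rfl
    have hcomp : ((fun i => (Sum.elim T (fun _ => counterTape s s) :
        ClockTape M → ℤ → TapeSym M.A) i 0) ∘ Sum.inl) = fun i => T i 0 := rfl
    by_cases hr : r = Fin.last d
    · refine ⟨s + 1, 0, by rw [ht, hr, Fin.val_last, Fin.val_zero]; ring, ?_⟩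
      simp only [clockTrans, hcomp]
      rw [hδ]
      simp only [if_pos hr]
      refine Prod.ext ?_ (funext fun i => ?_)
      · simp [hr]
      · rcases i with i | i
        · rfl
        · exact act_counterTape_mark s
    · have hlt : r < Fin.last d := lt_of_le_of_ne (Fin.le_last r) hr
      refine ⟨s, r + 1, by rw [ht, Fin.val_add_one_of_lt hlt]; ring, ?_⟩
      simp only [clockTrans, hcomp]
      rw [hδ]
      simp only [if_neg hr]
      refine Prod.ext rfl (funext fun i => ?_)
      rcases i with i | i
      · rfl
      · exact act_stay_self _

/-- If `M` halts after exactly `t + 1` steps, the clock runs for exactly `t + (s + 1)³ + 1` steps,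
where `s` is the quotient of `t` by `d + 1`. -/
theorem clock_run (w : List Bool) (t : ℕ) (hw : (M.run w t).state.IsWork)
    (hn : ¬ (M.run w (t + 1)).state.IsWork) :
    ((viewStep (clockTrans M d))^[t + (t / (d + 1) + 1) ^ 3] (clockInit M d w)).1.IsWork ∧
    ((viewStep (clockTrans M d))^[t + (t / (d + 1) + 1) ^ 3 + 1] (clockInit M d w)).1 = .halt := by
  rw [MultitapeTM.run_state] at hw hn
  obtain ⟨q, hq⟩ := hw
  obtain ⟨s, r, ht, hc⟩ := clock_count (d := d) w t q hq
  have hs : t / (d + 1) = s := by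
    rw [ht, mul_comm, Nat.mul_add_div (by omega), Nat.div_eq_of_lt r.isLt, add_zero]
  rw [hs]
  have h1 : ∃ T, (viewStep (clockTrans M d))^[t + 1] (clockInit M d w) =
      odometerConfig T s false false s s s := by
    rw [Function.iterate_succ_apply', hc]
    rw [Function.iterate_succ_apply'] at hn
    generalize (viewStep M.δ)^[t] (M.init w).view = c at hq hn
    rcases c with ⟨_, T⟩
    obtain rfl := hq
    rw [viewStep_work] at hn ⊢
    have hcomp : ((fun i => (Sum.elim T (fun _ => counterTape s s) :
        ClockTape M → ℤ → TapeSym M.A) i 0) ∘ Sum.inl) = fun i => T i 0 := rfl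
    refine ⟨fun i => act (T i) ((M.δ q fun i => T i 0).2 i).1 ((M.δ q fun i => T i 0).2 i).2, ?_⟩
    have hout : clockTrans M d (.count q r) (fun i => (Sum.elim T (fun _ => counterTape s s) :
        ClockTape M → ℤ → TapeSym M.A) i 0) = (.work (.odometer false false),
          Sum.elim (M.δ q fun i => T i 0).2 fun _ => (counterTape s s 0, .left)) := by
      simp only [clockTrans, hcomp]
      rcases hδ : M.δ q (fun i => T i 0) with ⟨p, a⟩
      rw [hδ] at hn
      rcases p with p | _ | _ | _
      · exact absurd ⟨p, rfl⟩ hn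
      all_goals rfl
    rw [hout]
    refine Prod.ext rfl (funext fun i => ?_)
    rcases i with i | i
    · rfl
    · have : act (counterTape s s) (counterTape s s 0) .left =
          (counterTape s (bouncePos s false s) : ℤ → TapeSym M.A) := by
        rw [act_counterTape]; rfl
      simp only [Sum.elim_inr, this]
      fin_cases i <;> rfl
  obtain ⟨T, hT⟩ := h1
  -- The last step of `M` moves the counter heads back onto their marks, so all three digits start
  -- at `s` and the value is `(s + 1) ^ 3 - 1`.
  have hrun := odometer_run (d := d) T false false ((s + 1) ^ 3 - 1) s s s le_rfl le_rfl le_rfl (by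
    rw [Nat.sub_eq_iff_eq_add (Nat.one_le_pow _ _ (by omega))]; ring)
  have hpos : 1 ≤ (s + 1) ^ 3 := Nat.one_le_pow _ _ (by omega)
  rw [← hT, ← Function.iterate_add_apply, ← Function.iterate_add_apply] at hrun
  have e1 : (s + 1) ^ 3 - 1 + (t + 1) = t + (s + 1) ^ 3 := by omega
  have e2 : (s + 1) ^ 3 - 1 + 1 + (t + 1) = t + (s + 1) ^ 3 + 1 := by omega
  rwa [e1, e2] at hrun

end Clock

/-! ### Running two machines in parallel -/

section Parallel

variable {Q₁ Q₂ ι₁ ι₂ A : Type}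

/-- The control state of two machines run in parallel: the second one answers, the first one may
interrupt it. -/
def Ctrl.parallel : Ctrl Q₁ → Ctrl Q₂ → Ctrl (Q₁ × Q₂)
  | .work q₁, .work q₂ => .work (q₁, q₂)
  | _, .yes => .yes
  | _, _ => .no

/-- Two machines on disjoint sets of tapes run in parallel. -/
def parallelTrans (δ₁ : TransFun Q₁ ι₁ A) (δ₂ : TransFun Q₂ ι₂ A) :
    TransFun (Q₁ × Q₂) (ι₁ ⊕ ι₂) A := fun q σ =>
  ((δ₁ q.1 (σ ∘ Sum.inl)).1.parallel (δ₂ q.2 (σ ∘ Sum.inr)).1,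
    Sum.elim (δ₁ q.1 (σ ∘ Sum.inl)).2 (δ₂ q.2 (σ ∘ Sum.inr)).2)

/-- A pair of configurations. -/
def pairConfig (c₁ : ViewConfig Q₁ ι₁ A) (c₂ : ViewConfig Q₂ ι₂ A) :
    ViewConfig (Q₁ × Q₂) (ι₁ ⊕ ι₂) A :=
  (c₁.1.parallel c₂.1, Sum.elim c₁.2 c₂.2)

variable {δ₁ : TransFun Q₁ ι₁ A} {δ₂ : TransFun Q₂ ι₂ A}

theorem viewStep_pairConfig {c₁ : ViewConfig Q₁ ι₁ A} {c₂ : ViewConfig Q₂ ι₂ A}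
    (h₁ : c₁.1.IsWork) (h₂ : c₂.1.IsWork) :
    viewStep (parallelTrans δ₁ δ₂) (pairConfig c₁ c₂) =
      pairConfig (viewStep δ₁ c₁) (viewStep δ₂ c₂) := by
  rcases c₁ with ⟨_, T₁⟩
  rcases c₂ with ⟨_, T₂⟩
  obtain ⟨q₁, rfl⟩ := h₁
  obtain ⟨q₂, rfl⟩ := h₂
  refine Prod.ext rfl (funext fun i => ?_)
  rcases i with i | i <;> rfl

theorem iterate_pairConfig {c₁ : ViewConfig Q₁ ι₁ A} {c₂ : ViewConfig Q₂ ι₂ A} {t : ℕ}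
    (h₁ : ∀ s < t, ((viewStep δ₁)^[s] c₁).1.IsWork)
    (h₂ : ∀ s < t, ((viewStep δ₂)^[s] c₂).1.IsWork) :
    (viewStep (parallelTrans δ₁ δ₂))^[t] (pairConfig c₁ c₂) =
      pairConfig ((viewStep δ₁)^[t] c₁) ((viewStep δ₂)^[t] c₂) := by
  induction t with
  | zero => rfl
  | succ t ih =>
    rw [Function.iterate_succ_apply', ih (fun s hs => h₁ s (by omega)) fun s hs => h₂ s (by omega),
      viewStep_pairConfig (h₁ t (by omega)) (h₂ t (by omega)), Function.iterate_succ_apply' (viewStep δ₁),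
      Function.iterate_succ_apply' (viewStep δ₂)]

theorem Ctrl.parallel_of_not_isWork_left {s₁ : Ctrl Q₁} (s₂ : Ctrl Q₂) (h : ¬ s₁.IsWork) :
    ∃ b, s₁.parallel s₂ = .answer b := by
  rcases s₁ with q | _ | _ | _
  · exact absurd ⟨q, rfl⟩ h
  all_goals
    rcases s₂ with _ | _ | _ | _
    exacts [⟨false, rfl⟩, ⟨true, rfl⟩, ⟨false, rfl⟩, ⟨false, rfl⟩]

theorem Ctrl.parallel_of_not_isWork_right (s₁ : Ctrl Q₁) {s₂ : Ctrl Q₂} (h : ¬ s₂.IsWork) :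
    ∃ b, s₁.parallel s₂ = .answer b := by
  rcases s₂ with q | _ | _ | _
  · exact absurd ⟨q, rfl⟩ h
  · exact ⟨true, by cases s₁ <;> rfl⟩
  all_goals exact ⟨false, by cases s₁ <;> rfl⟩

theorem Ctrl.parallel_answer (s₁ : Ctrl Q₁) (b : Bool) :
    s₁.parallel (.answer b : Ctrl Q₂) = .answer b := by
  cases b <;> cases s₁ <;> rfl

/-- If the first machine works until time `a`, the pair answers at time `a + 1` at the latest, and
gives the answer of the second machine if that comes by time `a`. -/
theorem parallel_answers {c₁ : ViewConfig Q₁ ι₁ A} {c₂ : ViewConfig Q₂ ι₂ A} {a : ℕ}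
    (h₂ : c₂.1.IsWork) (ha : ((viewStep δ₁)^[a] c₁).1.IsWork)
    (ha' : ¬ ((viewStep δ₁)^[a + 1] c₁).1.IsWork) :
    (∃ b, ((viewStep (parallelTrans δ₁ δ₂))^[a + 1] (pairConfig c₁ c₂)).1 = .answer b) ∧
    ∀ t ≤ a, ∀ b, ((viewStep δ₂)^[t] c₂).1 = .answer b →
      ((viewStep (parallelTrans δ₁ δ₂))^[a + 1] (pairConfig c₁ c₂)).1 = .answer b := by
  have hw₁ : ∀ s < a + 1, ((viewStep δ₁)^[s] c₁).1.IsWork :=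
    fun s hs => isWork_of_le δ₁ ha (by omega)
  by_cases hc : ((viewStep δ₂)^[a] c₂).1.IsWork
  · have h := iterate_pairConfig hw₁ fun s hs => isWork_of_le δ₂ hc (by omega : s ≤ a)
    rw [h]
    refine ⟨Ctrl.parallel_of_not_isWork_left _ ha', fun t ht b hb => ?_⟩
    exact absurd (hb ▸ isWork_of_le δ₂ hc ht) (Ctrl.not_isWork_answer b)
  · obtain ⟨s, hs, hsw, hsn⟩ := exists_last_isWork δ₂ h₂ hc
    have h := iterate_pairConfig (t := s + 1) (fun r hr => hw₁ r (by omega))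
      fun r hr => isWork_of_le δ₂ hsw (by omega : r ≤ s)
    obtain ⟨b, hb⟩ := Ctrl.parallel_of_not_isWork_right ((viewStep δ₁)^[s + 1] c₁).1 hsn
    have hb' : ((viewStep (parallelTrans δ₁ δ₂))^[s + 1] (pairConfig c₁ c₂)).1 = .answer b := by
      rw [h]; exact hb
    have hn : ¬ ((viewStep (parallelTrans δ₁ δ₂))^[s + 1] (pairConfig c₁ c₂)).1.IsWork := by
      rw [hb']; exact Ctrl.not_isWork_answer b
    -- The pair stops together with the second machine, at time `s + 1`, and its state is frozen
    -- from then on.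
    rw [viewStep_iterate_eq_of_le _ hn (by omega : s + 1 ≤ a + 1)]
    refine ⟨⟨b, hb'⟩, fun t ht b' hbt => ?_⟩
    have hst : s + 1 ≤ t := by
      by_contra hlt
      exact absurd (hbt ▸ isWork_of_le δ₂ hsw (by omega : t ≤ s)) (Ctrl.not_isWork_answer b')
    rw [viewStep_iterate_eq_of_le _ hsn hst] at hbt
    rw [h, pairConfig, hbt]
    exact Ctrl.parallel_answer _ _

end Parallel

/-! ### Copying the input -/

/-- The states of a machine that first copies its input. -/
inductive CopyState (Q : Type) : Type
  | copy
  | back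
  | main (q : Q)

instance {Q : Type} [Finite Q] : Finite (CopyState Q) :=
  Finite.of_surjective (fun x : Bool ⊕ Q => match x with
    | .inl false => CopyState.copy
    | .inl true => .back
    | .inr q => .main q) (by
    rintro (_ | _ | q)
    exacts [⟨.inl false, rfl⟩, ⟨.inl true, rfl⟩, ⟨.inr q, rfl⟩])

section Copy

variable {Q ι A : Type}

/-- The control state in which a main program goes on. -/
def Ctrl.toMain : Ctrl Q → Ctrl (CopyState Q)
  | .work q => .work (.main q)
  | .yes => .yes
  | .no => .no
  | .halt => .halt

/-- Copy the input from the tape `i₀` to the tapes selected by `tr`, rewind, then start `δ`. -/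
def copyTrans (i₀ : ι) (tr : ι → Bool) (q₀ : Q) (δ : TransFun Q ι A) :
    TransFun (CopyState Q) ι A
  | .copy, σ =>
    match (σ i₀).toOption with
    | some b => (.work .copy, fun i => if tr i then (.bit b, .right) else (σ i, .stay))
    | none => (.work .back, fun i => (σ i, if tr i then .left else .stay))
  | .back, σ =>
    match (σ i₀).toOption with
    | some _ => (.work .back, fun i => (σ i, if tr i then .left else .stay))
    | none => (.work (.main q₀), fun i => (σ i, if tr i then .right else .stay))
  | .main q, σ => ((δ q σ).1.toMain, (δ q σ).2)

variable {i₀ : ι} {tr : ι → Bool} {q₀ : Q} {δ : TransFun Q ι A} (w : List Bool)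

/-- The tapes with the word `u` and the head at `x` on the selected tapes. -/
def trackedTapes (tr : ι → Bool) (u : List Bool) (x : ℤ) (i : ι) : ℤ → TapeSym A :=
  if tr i then shiftTape (MultitapeTM.wordTape u) x else MultitapeTM.wordTape []

theorem act_trackedTapes (u : List Bool) (x : ℤ) (m : HeadMove) (i : ι) :
    act (trackedTapes tr u x i) (trackedTapes tr u x i 0) (if tr i then m else .stay) =
      (trackedTapes tr u (x + m.toInt) i : ℤ → TapeSym A) := by
  unfold trackedTapes
  split_ifs
  · rw [shiftTape_apply_zero, act_shiftTape]
  · exact act_stay_self _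

/-- The source tape is itself selected and rewrites its own letters. All selected heads thus advance
together, and one rewinding phase serves them all. -/
theorem copy_forward [DecidableEq ι] (j : ℕ) (hj : j ≤ w.length) (h₀ : tr i₀ = true) :
    (viewStep (copyTrans i₀ tr q₀ δ))^[j]
      (.work .copy, fun i => if i = i₀ then MultitapeTM.wordTape w else MultitapeTM.wordTape []) =
      (.work .copy, fun i => if i = i₀ then shiftTape (MultitapeTM.wordTape w) j
        else trackedTapes tr (w.take j) j i) := by
  induction j with
  | zero =>
    refine Prod.ext rfl (funext fun i => ?_)
    simp [trackedTapes, shiftTape_zero]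
  | succ j ih =>
    have hsym : (MultitapeTM.wordTape w (j : ℤ) : TapeSym A) = .bit w[j] := by
      rw [MultitapeTM.wordTape_natCast, List.getElem?_eq_getElem (by omega)]; rfl
    rw [Function.iterate_succ_apply', ih (by omega), viewStep_work]
    simp only [copyTrans, if_true, shiftTape_apply_zero, hsym, TapeSym.toOption]
    refine Prod.ext rfl (funext fun i => ?_)
    by_cases hi : i = i₀
    · subst hi
      simp only [if_true, h₀]
      have := act_shiftTape (MultitapeTM.wordTape w : ℤ → TapeSym A) j .right
      rw [hsym] at this
      rw [this]
      simp [HeadMove.toInt]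
    · simp only [if_neg hi]
      unfold trackedTapes
      split_ifs
      · have := MultitapeTM.act_shiftTape_wordTape (A := A) (w.take j) w[j]
        rw [List.length_take, min_eq_left (by omega)] at this
        rw [this, List.take_succ_eq_append_getElem (by omega)]
        push_cast
        rfl
      · exact act_stay_self _

theorem copy_back (p : ℕ) (hp : p ≤ w.length) (h₀ : tr i₀ = true) :
    (viewStep (copyTrans i₀ tr q₀ δ))^[p] (.work .back, trackedTapes tr w (p - 1 : ℤ)) =
      (.work .back, trackedTapes tr w (-1)) := by
  induction p with
  | zero => simp
  | succ p ih =>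
    have hx : ((p + 1 : ℕ) : ℤ) - 1 = p := by push_cast; ring
    have hsym : (trackedTapes tr w (p : ℤ) i₀ 0 : TapeSym A) = .bit w[p] := by
      rw [trackedTapes, if_pos h₀, shiftTape_apply_zero, MultitapeTM.wordTape_natCast,
        List.getElem?_eq_getElem (by omega)]
      rfl
    rw [Function.iterate_succ_apply, hx, viewStep_work]
    simp only [copyTrans, hsym, TapeSym.toOption, act_trackedTapes]
    exact ih (by omega)

/-- After the copying phase, the selected tapes hold the input. -/
theorem copy_run [DecidableEq ι] (h₀ : tr i₀ = true) :
    (viewStep (copyTrans i₀ tr q₀ δ))^[2 * w.length + 2]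
      (.work .copy, fun i => if i = i₀ then MultitapeTM.wordTape w else MultitapeTM.wordTape []) =
      (.work (.main q₀), fun i =>
        if tr i then MultitapeTM.wordTape w else MultitapeTM.wordTape []) := by
  have h1 := copy_forward (q₀ := q₀) (δ := δ) (A := A) w w.length le_rfl h₀
  have htapes : (fun i => if i = i₀ then shiftTape (MultitapeTM.wordTape w) w.length
      else trackedTapes tr (w.take w.length) w.length i : ι → ℤ → TapeSym A) =
      trackedTapes tr w w.length := by
    funext i
    by_cases hi : i = i₀
    · subst hi; simp [trackedTapes, h₀]
    · simp [hi]
  rw [htapes] at h1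
  have hsym : ∀ x : ℤ, (MultitapeTM.wordTape w x : TapeSym A) = .blank →
      (trackedTapes tr w x i₀ 0 : TapeSym A).toOption = none := by
    intro x hx
    rw [trackedTapes, if_pos h₀, shiftTape_apply_zero, hx]
    rfl
  have h2 : (viewStep (copyTrans i₀ tr q₀ δ))^[1]
      (.work .copy, trackedTapes tr w (w.length : ℤ)) =
      (.work .back, trackedTapes tr w (w.length - 1 : ℤ)) := by
    rw [Function.iterate_one, viewStep_work]
    simp only [copyTrans, hsym _ (MultitapeTM.wordTape_of_length_le w le_rfl), act_trackedTapes]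
    rfl
  have h3 := copy_back (q₀ := q₀) (δ := δ) (A := A) w w.length le_rfl h₀
  have h4 : (viewStep (copyTrans i₀ tr q₀ δ))^[1] (.work .back, trackedTapes tr w (-1)) =
      (.work (.main q₀), trackedTapes tr w 0) := by
    rw [Function.iterate_one, viewStep_work]
    simp only [copyTrans, hsym _ (MultitapeTM.wordTape_of_neg w (by omega : (-1 : ℤ) < 0)),
      act_trackedTapes]
    rfl
  have := iterate_trans (iterate_trans (iterate_trans h1 h2) h3) h4
  rw [show 2 * w.length + 2 = 1 + (w.length + (1 + w.length)) by ring, this]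
  refine Prod.ext rfl (funext fun i => ?_)
  simp [trackedTapes, shiftTape_zero]

theorem main_run (c : ViewConfig Q ι A) (t : ℕ) :
    (viewStep (copyTrans i₀ tr q₀ δ))^[t] (c.1.toMain, c.2) =
      (((viewStep δ)^[t] c).1.toMain, ((viewStep δ)^[t] c).2) := by
  have hs : Function.Semiconj (fun c : ViewConfig Q ι A => (c.1.toMain, c.2)) (viewStep δ)
      (viewStep (copyTrans i₀ tr q₀ δ)) := by
    rintro ⟨_ | _ | _ | _, T⟩ <;> rfl
  exact (hs.iterate_right t c).symm

end Copy

/-! ### The diagonal machine -/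

/-- The tapes holding the input after the copying phase. -/
def inputTracks (M : MultitapeTM) : ClockTape M ⊕ InterpTape → Bool
  | .inl (.inl i) => decide (i = 0)
  | .inr .prog => true
  | .inr .inp => true
  | _ => false

/-- Given a machine `M` used as a timer, there is a machine that runs the interpreter on its input
for `t + (t / (d + 1) + 1)³` steps, where `M` halts after `t + 1` steps. -/
theorem exists_clocked_interpreter (M : MultitapeTM) (d : ℕ) :
    ∃ U : MultitapeTM, ∀ (w : List Bool) (t : ℕ), (M.run w t).state.IsWork →
      ¬ (M.run w (t + 1)).state.IsWork →
      (∃ b, (U.run w (t + (t / (d + 1) + 1) ^ 3 + 1 + (2 * w.length + 2))).state = .answer b) ∧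
      ∀ t' ≤ t + (t / (d + 1) + 1) ^ 3, ∀ b,
        ((viewStep interpTrans)^[t'] (interpConfig w .rewind 0 0
          (addressTape 0 : ℤ → TapeSym M.A) fun _ => none)).1 = .answer b →
        (U.run w (t + (t / (d + 1) + 1) ^ 3 + 1 + (2 * w.length + 2))).state = .answer b := by
  classical
  let i₀ : ClockTape M ⊕ InterpTape := .inl (.inl 0)
  obtain ⟨k, e, he⟩ := exists_equiv_fin_map_zero i₀
  let δ := copyTrans i₀ (inputTracks M) (ClockState.count M.start 0, InterpState.rewind)
    (parallelTrans (clockTrans M d) interpTrans)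
  refine ⟨MultitapeTM.ofTrans e .copy δ, fun w t hw hn => ?_⟩
  set a := t + (t / (d + 1) + 1) ^ 3 with ha
  set c₂ : ViewConfig InterpState InterpTape M.A :=
    interpConfig w .rewind 0 0 (addressTape 0) fun _ => none with hc₂
  obtain ⟨hwork, hhalt⟩ := clock_run (d := d) w t hw hn
  have hpar := parallel_answers (δ₁ := clockTrans M d) (δ₂ := interpTrans)
    (c₁ := clockInit M d w) (c₂ := c₂) (a := a) ⟨_, rfl⟩ hwork
    (by rw [hhalt]; rintro ⟨q, hq⟩; simp at hq)
  have hstate : ((MultitapeTM.ofTrans e .copy δ).run w (a + 1 + (2 * w.length + 2))).state =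
      ((viewStep (parallelTrans (clockTrans M d) interpTrans))^[a + 1]
        (pairConfig (clockInit M d w) c₂)).1.toMain := by
    rw [MultitapeTM.run_ofTrans_state]
    have hinit : (fun i => if e i = 0 then MultitapeTM.wordTape w else MultitapeTM.wordTape [] :
        ClockTape M ⊕ InterpTape → ℤ → TapeSym M.A) =
        fun i => if i = i₀ then MultitapeTM.wordTape w else MultitapeTM.wordTape [] := by
      funext i
      have : e i = 0 ↔ i = i₀ := by rw [← he, e.injective.eq_iff]
      simp [this]
    have hstart : ((.work (.main (ClockState.count M.start 0, InterpState.rewind)), fun i =>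
        if inputTracks M i then MultitapeTM.wordTape w else MultitapeTM.wordTape []) :
        ViewConfig (CopyState (ClockState M d × InterpState)) (ClockTape M ⊕ InterpTape) M.A) =
        ((pairConfig (clockInit M d w) c₂).1.toMain, (pairConfig (clockInit M d w) c₂).2) := by
      refine Prod.ext rfl (funext fun i => ?_)
      rcases i with (i | i) | i
      · simp [pairConfig, clockInit, MultitapeTM.view_init, inputTracks]
      · rfl
      · cases i
        · exact (shiftTape_zero _).symm
        · exact (shiftTape_zero _).symm
        · exact MultitapeTM.wordTape_eq_splitTape []
        · funext z
          exact MultitapeTM.wordTape_nil z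
    rw [hinit, Function.iterate_add_apply, copy_run w (by simp [inputTracks, i₀]), hstart, main_run]
  have htoMain : ∀ b, (Ctrl.answer b : Ctrl (ClockState M d × InterpState)).toMain = .answer b := by
    rintro (_ | _) <;> rfl
  rw [hstate]
  refine ⟨?_, fun t' ht' b hb => ?_⟩
  · obtain ⟨b, hb⟩ := hpar.1
    exact ⟨b, by rw [hb, htoMain]; rfl⟩
  · rw [hpar.2 t' ht' b hb, htoMain]; rfl

/-! ### Density of words with a given prefix -/

theorem ncard_length_eq (n : ℕ) : {w : List Bool | w.length = n}.ncard = 2 ^ n := by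
  have h : Nat.card {w : List Bool // w.length = n} = 2 ^ n := by
    have := card_vector (α := Bool) n
    rw [Fintype.card_bool] at this
    rw [← this, ← Nat.card_eq_fintype_card]
    rfl
  rw [← h]
  rfl

theorem finite_wordBall (n : ℕ) : (wordBall n).Finite := List.finite_length_le Bool n

theorem ncard_wordBall_lt (n : ℕ) : (wordBall n).ncard < 2 ^ (n + 1) := by
  induction n with
  | zero =>
    have : wordBall 0 = {w : List Bool | w.length = 0} := by
      ext w; simp [wordBall]
    rw [this, ncard_length_eq]
    norm_num
  | succ n ih =>
    have : wordBall (n + 1) = wordBall n ∪ {w : List Bool | w.length = n + 1} := by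
      ext w
      simp only [wordBall, Set.mem_ofPred_eq, Set.mem_union]
      omega
    have h := Set.ncard_union_le (wordBall n) {w : List Bool | w.length = n + 1}
    rw [← this, ncard_length_eq] at h
    rw [pow_succ 2 (n + 1)]
    omega

/-- A set missing all long words with the prefix `u` is not generic. -/
theorem not_isGeneric_of_prefix {S : Set (List Bool)} (u : List Bool) (N : ℕ)
    (h : ∀ v : List Bool, N ≤ (u ++ v).length → u ++ v ∉ S) : ¬ IsGeneric S := by
  intro hS
  have hpos : (0 : ℝ) < 1 / 2 ^ (u.length + 1) := by positivity
  have hev := hS.eventually_const_lt (by linarith : 1 - 1 / (2 : ℝ) ^ (u.length + 1) < 1)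
  obtain ⟨n, hlt, hn⟩ := (hev.and (eventually_ge_atTop (N + u.length))).exists
  -- The words with prefix `u` of length exactly `n` suffice: there are `2 ^ (n - |u|)` of them,
  -- against fewer than `2 ^ (n + 1)` words in the ball.
  set P : Set (List Bool) := (fun v => u ++ v) '' {v | v.length = n - u.length} with hP
  have hPcard : P.ncard = 2 ^ (n - u.length) := by
    rw [hP, Set.ncard_image_of_injective _ (List.append_right_injective u), ncard_length_eq]
  have hPB : P ⊆ wordBall n := by
    rintro _ ⟨v, hv, rfl⟩
    simp only [Set.mem_ofPred_eq] at hv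
    simp only [wordBall, Set.mem_ofPred_eq, List.length_append]
    omega
  have hdisj : Disjoint (S ∩ wordBall n) P := by
    rw [Set.disjoint_right]
    rintro _ ⟨v, hv, rfl⟩ hmem
    simp only [Set.mem_ofPred_eq] at hv
    exact h v (by rw [List.length_append]; omega) hmem.1
  have hcard : (S ∩ wordBall n).ncard + 2 ^ (n - u.length) ≤ (wordBall n).ncard := by
    rw [← hPcard, ← Set.ncard_union_eq hdisj ((finite_wordBall n).subset Set.inter_subset_right)
      ((finite_wordBall n).subset hPB)]
    exact Set.ncard_le_ncard (Set.union_subset Set.inter_subset_right hPB) (finite_wordBall n)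
  have hB := ncard_wordBall_lt n
  set x := (S ∩ wordBall n).ncard with hx
  set B := (wordBall n).ncard with hBdef
  have hpow : 2 ^ (n + 1) = 2 ^ (n - u.length) * 2 ^ (u.length + 1) := by
    rw [← pow_add]; congr 1; omega
  have hBpos : (0 : ℝ) < B := by
    have : 0 < 2 ^ (n - u.length) := by positivity
    exact_mod_cast (by omega : 0 < B)
  have hle : wordDensity S n ≤ 1 - 1 / (2 : ℝ) ^ (u.length + 1) := by
    unfold wordDensity
    rw [← hx, ← hBdef, div_le_iff₀ hBpos]
    have h1 : (x : ℝ) + 2 ^ (n - u.length) ≤ B := by exact_mod_cast hcard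
    have h2 : (B : ℝ) ≤ 2 ^ (n - u.length) * 2 ^ (u.length + 1) := by
      rw [hpow] at hB
      exact_mod_cast hB.le
    have h3 : 1 / (2 : ℝ) ^ (u.length + 1) * B ≤ 2 ^ (n - u.length) := by
      rw [one_div, inv_mul_le_iff₀ (by positivity)]
      linarith
    linarith
  linarith

/-! ### The hierarchy theorem -/

theorem MultitapeTM.run_state_eq_of_le (M : MultitapeTM) {w : List Bool} {s t : ℕ} {b : Bool}
    (h : (M.run w s).state = .answer b) (hst : s ≤ t) : (M.run w t).state = .answer b := by
  rw [M.run_eq_of_le (by rw [h]; exact Ctrl.not_isWork_answer b) hst, h]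

/-- The language accepted by a machine. -/
def MultitapeTM.language (M : MultitapeTM) : Language Bool := {w | ∃ t, M.AcceptsIn w t}

theorem MultitapeTM.mem_language_iff (M : MultitapeTM) {w : List Bool} {t : ℕ} {b : Bool}
    (h : (M.run w t).state = .answer b) : w ∈ M.language ↔ b = true := by
  constructor
  · rintro ⟨s, hs⟩
    have h1 := M.run_state_eq_of_le (b := true) hs (le_max_left s t)
    rw [M.run_state_eq_of_le h (le_max_right s t)] at h1
    cases b
    · simp [Ctrl.answer] at h1
    · rfl
  · rintro rfl
    exact ⟨t, h⟩

theorem MultitapeTM.decidesIn_language (M : MultitapeTM) {w : List Bool} {s t : ℕ} {b : Bool}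
    (h : (M.run w s).state = .answer b) (hst : s ≤ t) : M.DecidesIn M.language w t := by
  have ht := M.run_state_eq_of_le h hst
  cases b
  · exact .inr ⟨by simp [M.mem_language_iff h], ht⟩
  · exact .inl ⟨by simp [M.mem_language_iff h], ht⟩

theorem MultitapeTM.DecidesIn.exists_answer {M : MultitapeTM} {L : Language Bool} {w : List Bool}
    {t : ℕ} (h : M.DecidesIn L w t) : ∃ b, (M.run w t).state = .answer b ∧ (w ∈ L ↔ b = true) := by
  rcases h with ⟨hL, h⟩ | ⟨hL, h⟩
  · exact ⟨true, h, by simp [hL]⟩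
  · exact ⟨false, h, by simp [hL]⟩

/-- Division by `8 * (c + 1)` leaves a quotient `s` of about `F / 4` at most, so `2 * (s + 1) ≤ F`
and the odometer takes at most an eighth of `F ^ 3`. The remaining terms are at most `(3 * c + 8) *
F ≤ F ^ 2`, another eighth at most because `8 ≤ F`. -/
theorem clock_le_cube {c n F t : ℕ} (hn : n ≤ F) (hF : 3 * c + 8 ≤ F)
    (ht : t + 1 ≤ c * (n + F) + c) :
    t + (t / (8 * c + 7 + 1) + 1) ^ 3 + 1 + (2 * n + 2) ≤ F ^ 3 := by
  set s := t / (8 * c + 7 + 1) with hs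
  have h1 : (8 * c + 7 + 1) * s ≤ t := Nat.mul_div_le t _
  have h2 : c * (n + F) ≤ c * (2 * F) := Nat.mul_le_mul_left c (by omega)
  have h3 : 8 * s ≤ 2 * F + 1 := by
    have : (c + 1) * (8 * s) ≤ (c + 1) * (2 * F + 1) := by nlinarith
    exact Nat.le_of_mul_le_mul_left this (by omega)
  have h4 : (2 * (s + 1)) ^ 3 ≤ F ^ 3 := Nat.pow_le_pow_left (by omega) 3
  have h5 : (2 * (s + 1)) ^ 3 = 8 * (s + 1) ^ 3 := by ring
  have h6 : t + 1 + (2 * n + 2) ≤ (3 * c + 8) * F := by nlinarith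
  have h7 : (3 * c + 8) * F ≤ F * F := Nat.mul_le_mul_right F hF
  have h8 : 8 * (F * F) ≤ F ^ 3 := by
    calc 8 * (F * F) ≤ F * (F * F) := Nat.mul_le_mul_right _ (by omega)
      _ = F ^ 3 := by ring
  omega

/-- Since `F ≤ D * (s + 1)`, the odometer runs for at least `F ^ 3 / D ^ 3` steps. The threshold on
`F` lets one factor `F` absorb `D ^ 3` and the coefficient of the quadratic bound. -/
theorem quadratic_le_clock {D Z C F t : ℕ} (hD : 0 < D) (hF : D ^ 3 * Z * (C + 1) ^ 2 + 1 ≤ F)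
    (ht : F ≤ t + 1) : Z * (C * F + 1) ^ 2 ≤ t + (t / D + 1) ^ 3 := by
  set s := t / D with hs
  have h1 : F ≤ D * (s + 1) := by
    have := Nat.lt_mul_div_succ t hD
    rw [← hs] at this
    omega
  have h2 : F ^ 3 ≤ (D * (s + 1)) ^ 3 := Nat.pow_le_pow_left h1 3
  have hF1 : 1 ≤ F := by omega
  have h3 : (C * F + 1) ^ 2 ≤ ((C + 1) * F) ^ 2 := Nat.pow_le_pow_left (by linarith) 2
  have h4 : D ^ 3 * (Z * (C * F + 1) ^ 2) ≤ D ^ 3 * (s + 1) ^ 3 := by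
    calc D ^ 3 * (Z * (C * F + 1) ^ 2) ≤ D ^ 3 * (Z * ((C + 1) * F) ^ 2) := by gcongr
      _ = D ^ 3 * Z * (C + 1) ^ 2 * F ^ 2 := by ring
      _ ≤ F * F ^ 2 := Nat.mul_le_mul_right _ (by omega)
      _ = F ^ 3 := by ring
      _ ≤ (D * (s + 1)) ^ 3 := h2
      _ = D ^ 3 * (s + 1) ^ 3 := by ring
  have h5 := Nat.le_of_mul_le_mul_left h4 (by positivity)
  omega

theorem theorem9p3 (f : ℕ → ℕ) (hf : IsProperComplexity f) (hfn : ∀ n, n ≤ f n) :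
    ∃ L : Language Bool, ComputableInTime L (fun n => f n ^ 3) ∧
      ∀ C : ℕ, ¬ GenericallyComputableInTime L (fun n => C * f n) := by
  obtain ⟨M, c, hM⟩ := hf.exists_timer
  obtain ⟨U, hU⟩ := exists_clocked_interpreter M (8 * c + 7)
  refine ⟨U.language, ⟨U, fun w => ?_, 3 * c + 8, fun w hw => ?_⟩, fun C => ?_⟩
  · obtain ⟨t, hwork, hn, -, -⟩ := hM w
    obtain ⟨⟨b, hb⟩, -⟩ := hU w t hwork hn
    exact ⟨_, U.decidesIn_language hb le_rfl⟩
  · obtain ⟨t, hwork, hn, -, ht⟩ := hM w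
    obtain ⟨⟨b, hb⟩, -⟩ := hU w t hwork hn
    exact U.decidesIn_language hb (clock_le_cube (hfn _) (hw.trans (hfn _)) ht)
  · rintro ⟨M', hgen⟩
    obtain ⟨u, Z, hu⟩ := M'.exists_program
    -- The threshold is that of `quadratic_le_clock` with `D = 8 * c + 8`; it passes from the length
    -- of the word to `f` because `n ≤ f n`.
    refine not_isGeneric_of_prefix u ((8 * c + 7 + 1) ^ 3 * Z * (C + 1) ^ 2 + 1)
      (fun v hv hmem => ?_) hgen
    obtain ⟨b, hb, hL⟩ := MultitapeTM.DecidesIn.exists_answer hmem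
    obtain ⟨t, hwork, hn, hft, -⟩ := hM (u ++ v)
    obtain ⟨t', ht', hans⟩ := hu M.A v _ b hb
    have hUb := (hU (u ++ v) t hwork hn).2 t'
      (ht'.trans (quadratic_le_clock (by omega) (hv.trans (hfn _)) hft)) _ hans
    -- `U` answers `!b` where `M'` answers `b`, so membership in `L` would be equivalent both to `b
    -- = true` and to `!b = true`.
    rw [U.mem_language_iff hUb] at hL
    cases b <;> simp at hL
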